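/- Let $n\ge 0$, let $V\subset\mathbb{R}^{n+1}$ be an open subset and $k\in(1,\infty)$. A hypersurface $\mathcal{H}\subset\mathbb{R}^{n+1}$ is *centroaffine* if the position vector field $\xi$ is transversal to it; its centroaffine metric $g$ is then defined by the Gauss equation $\tilde\nabla_XY=\nabla_XY+g(X,Y)\,\xi$ for tangent vector fields $X,Y$, where $\tilde\nabla$ is the flat connection of $\mathbb{R}^{n+1}$ and $\nabla_XY$ is tangent to $\mathcal H$. It is *hyperbolic* if $g$ is positive definite, and *Euclidean complete* if it is complete for the Riemannian metric induced by the Euclidean scalar product. Let $\mathcal{F}=\mathcal{F}(V,k)\subset C^\infty(V)$ be the set of smooth functions $h:V\to\mathbb{R}$ which are homogeneous of degree $k$, i.e. $\sum_i x^i\,\partial h/\partial x^i=kh$ on $V$, and for which there exists an open cone $U\subset V$ with $\overline U\setminus\{0\}\subset V$ such that $$\mathcal{H}(h,U)=\{p\in U \mid h(p)=1\}$$ is a (nonempty) Euclidean complete connected hyperbolic centroaffine hypersurface. For such $h$ and $U$, put $U_0=\mathbb{R}^{>0}\cdot\mathcal{H}(h,U)$. The hypersurface $\mathcal{H}(h,U)$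 has *regular boundary behaviour* if $dh_p\neq 0$ for all $p\in\partial U_0\setminus\{0\}$, and $-\tilde\nabla^2h$ is positive semi-definite with exactly one-dimensional kernel on the tangent spaces of $\partial U_0\setminus\{0\}$. Let $\mathcal{F}_{reg}=\mathcal{F}_{reg}(V,k)$ be the set of those $h\in\mathcal{F}$ for which $\mathcal{H}(h,U)$ has regular boundary behaviour for some $U$ as above. Endow $\mathcal{F}$ with the topology induced by the standard Fréchet topology of $C^\infty(V)$, defined by the seminorms $h\mapsto\sup_K|\tilde\nabla^\ell h|$ for $K\subset V$ compact and $\ell=0,1,2,\dots$ Then $\mathcal{F}_{reg}$ is dense in $\mathcal{F}$. If moreover $V$ is a cone (that is, $tV\subset V$ for all $t>0$), then $\mathcal{F}_{reg}$ is also open in $\mathcal{F}$. -/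

import Mathlib

open Set Filter Topology
open scoped ContDiff ENNReal

noncomputable section

/-! ### Hypersurfaces and centroaffine geometry -/

/-- `γ` is a smooth curve, defined on some open interval around `0`, which runs inside `S` and
passes through `p` at time `0`. -/
def IsCurveIn {E : Type*} [NormedAddCommGroup E] [NormedSpace ℝ E]
    (S : Set E) (p : E) (γ : ℝ → E) : Prop :=
  γ 0 = p ∧ ∃ δ : ℝ, 0 < δ ∧ ContDiffOn ℝ ∞ γ (Ioo (-δ) δ) ∧ MapsTo γ (Ioo (-δ) δ) S

/-- The tangent space `T_p S`: spanned by the velocities at `p` of the smooth curves in `S`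
through `p`. -/
def tangentSpaceAt {E : Type*} [NormedAddCommGroup E] [NormedSpace ℝ E]
    (S : Set E) (p : E) : Submodule ℝ E :=
  Submodule.span ℝ {v | ∃ γ : ℝ → E, IsCurveIn S p γ ∧ deriv γ 0 = v}

/-- `S` is a smooth embedded hypersurface: near each of its points it is the zero set of a smooth
function with nonvanishing differential. -/
def IsSmoothHypersurface {E : Type*} [NormedAddCommGroup E] [NormedSpace ℝ E]
    (S : Set E) : Prop :=
  ∀ p ∈ S, ∃ (W : Set E) (f : E → ℝ), IsOpen W ∧ p ∈ W ∧ ContDiffOn ℝ ∞ f W ∧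
    (∀ x ∈ W, fderiv ℝ f x ≠ 0) ∧ S ∩ W = {x ∈ W | f x = 0}

/-- `S` is a centroaffine hypersurface: the position vector is transversal to `S`. -/
def IsCentroaffine {E : Type*} [NormedAddCommGroup E] [NormedSpace ℝ E]
    (S : Set E) : Prop :=
  IsSmoothHypersurface S ∧ ∀ p ∈ S, p ∉ tangentSpaceAt S p

/-- The Gauss equation `∇̃_X X = ∇_X X + g(X, X) ξ` along the curve `γ` at time `0`, where
`X = γ'` and `ξ` is the position vector: the acceleration of `γ` is a tangent vector plus
`c` times the position vector. For a curve in a centroaffine hypersurface this determines `c`,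
namely `c = g(γ'(0), γ'(0))` with `g` the centroaffine metric. -/
def IsGaussCoefficient {E : Type*} [NormedAddCommGroup E] [NormedSpace ℝ E]
    (S : Set E) (γ : ℝ → E) (c : ℝ) : Prop :=
  deriv (deriv γ) 0 - c • γ 0 ∈ tangentSpaceAt S (γ 0)

/-- `S` is a hyperbolic centroaffine hypersurface: the centroaffine metric `g` is positive
definite, i.e. `g(X, X) > 0` for every tangent vector `X = γ'(0) ≠ 0`. -/
def IsHyperbolicCentroaffine {E : Type*} [NormedAddCommGroup E] [NormedSpace ℝ E]
    (S : Set E) : Prop :=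
  IsCentroaffine S ∧ ∀ p ∈ S, ∀ γ : ℝ → E, IsCurveIn S p γ → deriv γ 0 ≠ 0 →
    ∃ c : ℝ, 0 < c ∧ IsGaussCoefficient S γ c

/-- The Riemannian distance on `S` of the metric induced by the norm of the ambient space: the
infimum of the lengths of the `C¹` curves in `S` which join two points (`⊤` if there is none). -/
def inducedEDist {E : Type*} [NormedAddCommGroup E] [NormedSpace ℝ E]
    (S : Set E) (x y : E) : ℝ≥0∞ :=
  ⨅ γ ∈ {γ : ℝ → E | ContDiffOn ℝ 1 γ (Icc 0 1) ∧ MapsTo γ (Icc 0 1) S ∧ γ 0 = x ∧ γ 1 = y},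
    ∫⁻ t in Icc (0 : ℝ) 1, ‖derivWithin γ (Icc 0 1) t‖ₑ

/-- `S` is Euclidean complete: with its induced Riemannian distance, every Cauchy sequence in `S`
converges to a point of `S`. -/
def IsEuclideanComplete {E : Type*} [NormedAddCommGroup E] [NormedSpace ℝ E]
    (S : Set E) : Prop :=
  ∀ u : ℕ → E, (∀ i, u i ∈ S) →
    (∀ ε : ℝ≥0∞, 0 < ε → ∃ N, ∀ i ≥ N, ∀ j ≥ N, inducedEDist S (u i) (u j) < ε) →
    ∃ x ∈ S, Tendsto (fun i => inducedEDist S (u i) x) atTop (𝓝 0)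

/-! ### The Fréchet space of smooth functions on an open set -/

/-- A smooth function on `V` is represented by its extension by zero to the ambient space. -/
def smoothSubmodule {E : Type*} [NormedAddCommGroup E] [NormedSpace ℝ E]
    (V : TopologicalSpace.Opens E) : Submodule ℝ (E → ℝ) where
  carrier := {h | ContDiffOn ℝ ∞ h V ∧ ∀ x ∉ V, h x = 0}
  add_mem' := fun {f g} hf hg =>
    ⟨hf.1.add hg.1, fun x hx => by simp [hf.2 x hx, hg.2 x hx]⟩
  zero_mem' := ⟨contDiffOn_const, fun _ _ => rfl⟩
  smul_mem' := fun c f hf => ⟨hf.1.const_smul c, fun x hx => by simp [hf.2 x hx]⟩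

/-- The space `C^∞(V)` of smooth real functions on the open set `V`. -/
def SmoothFunctions {E : Type*} [NormedAddCommGroup E] [NormedSpace ℝ E]
    (V : TopologicalSpace.Opens E) : Type _ :=
  ↥(smoothSubmodule V)

instance {E : Type*} [NormedAddCommGroup E] [NormedSpace ℝ E]
    (V : TopologicalSpace.Opens E) : AddCommGroup (SmoothFunctions V) :=
  inferInstanceAs (AddCommGroup ↥(smoothSubmodule V))

instance {E : Type*} [NormedAddCommGroup E] [NormedSpace ℝ E]
    (V : TopologicalSpace.Opens E) : Module ℝ (SmoothFunctions V) :=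
  inferInstanceAs (Module ℝ ↥(smoothSubmodule V))

/-- The underlying function (equal to zero outside `V`). -/
def SmoothFunctions.toFun {E : Type*} [NormedAddCommGroup E] [NormedSpace ℝ E]
    {V : TopologicalSpace.Opens E} (h : SmoothFunctions V) : E → ℝ :=
  h.val

theorem SmoothFunctions.contDiffAt {E : Type*} [NormedAddCommGroup E] [NormedSpace ℝ E]
    {V : TopologicalSpace.Opens E} (h : SmoothFunctions V) {x : E} (hx : x ∈ V) :
    ContDiffAt ℝ ∞ h.toFun x :=
  h.property.1.contDiffAt (V.isOpen.mem_nhds hx)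

theorem SmoothFunctions.bddAbove {E : Type*} [NormedAddCommGroup E] [NormedSpace ℝ E]
    {V : TopologicalSpace.Opens E} (h : SmoothFunctions V) (l : ℕ)
    (K : {K : TopologicalSpace.Compacts E // (K : Set E) ⊆ V}) :
    BddAbove (range fun x : (K.1 : Set E) => ‖iteratedFDeriv ℝ l h.toFun x‖) := by
  have hc : ContinuousOn (iteratedFDeriv ℝ l h.toFun) V :=
    (h.property.1.continuousOn_iteratedFDerivWithin (m := l) (by exact_mod_cast le_top)
      V.isOpen.uniqueDiffOn).congr
      fun x hx => (iteratedFDerivWithin_of_isOpen l V.isOpen hx).symm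
  have := K.1.isCompact.bddAbove_image (hc.mono K.2).norm
  rwa [image_eq_range] at this

/-- The family of seminorms `h ↦ sup_K ‖∇̃^l h‖`, indexed by the compact sets `K ⊆ V` and
by `l = 0, 1, …` (in finite dimension the choice of the norm on tensors does not matter for the
resulting topology). -/
def smoothSeminorms {E : Type*} [NormedAddCommGroup E] [NormedSpace ℝ E]
    (V : TopologicalSpace.Opens E) :
    SeminormFamily ℝ (SmoothFunctions V)
      ({K : TopologicalSpace.Compacts E // (K : Set E) ⊆ V} × ℕ) := fun i =>
  Seminorm.of (fun h => ⨆ x : (i.1.1 : Set E), ‖iteratedFDeriv ℝ i.2 h.toFun x‖)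
    (fun f g => by
      refine Real.iSup_le (fun x => ?_) (add_nonneg
        (Real.iSup_nonneg fun _ => norm_nonneg _) (Real.iSup_nonneg fun _ => norm_nonneg _))
      have hadd : iteratedFDeriv ℝ i.2 (f + g).toFun x
          = iteratedFDeriv ℝ i.2 f.toFun x + iteratedFDeriv ℝ i.2 g.toFun x :=
        iteratedFDeriv_add_apply ((f.contDiffAt (i.1.2 x.2)).of_le (by exact_mod_cast le_top))
          ((g.contDiffAt (i.1.2 x.2)).of_le (by exact_mod_cast le_top))
      rw [hadd]
      exact (norm_add_le _ _).trans
        (add_le_add (le_ciSup (f.bddAbove i.2 i.1) x) (le_ciSup (g.bddAbove i.2 i.1) x)))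
    (fun c f => by
      rw [Real.mul_iSup_of_nonneg (norm_nonneg c)]
      refine iSup_congr fun x => ?_
      have hsmul : iteratedFDeriv ℝ i.2 (c • f).toFun x = c • iteratedFDeriv ℝ i.2 f.toFun x :=
        iteratedFDeriv_const_smul_apply
          ((f.contDiffAt (i.1.2 x.2)).of_le (by exact_mod_cast le_top))
      rw [hsmul, norm_smul])

instance {E : Type*} [NormedAddCommGroup E] [NormedSpace ℝ E]
    (V : TopologicalSpace.Opens E) :
    Nonempty ({K : TopologicalSpace.Compacts E // (K : Set E) ⊆ V} × ℕ) :=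
  ⟨⟨⟨⊥, by simp⟩, 0⟩⟩

/-- The standard Fréchet topology on `C^∞(V)`: the locally convex topology defined by the
seminorms `sup_K ‖∇̃^l h‖`. -/
instance {E : Type*} [NormedAddCommGroup E] [NormedSpace ℝ E]
    (V : TopologicalSpace.Opens E) : TopologicalSpace (SmoothFunctions V) :=
  (smoothSeminorms V).moduleFilterBasis.topology

/-! ### Homogeneous functions with hyperbolic level sets -/

/-- `U` is invariant under multiplication by positive numbers. -/
def IsCone {E : Type*} [NormedAddCommGroup E] [NormedSpace ℝ E] (U : Set E) : Prop :=
  ∀ t : ℝ, 0 < t → ∀ x ∈ U, t • x ∈ U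

/-- The cone `ℝ^{>0} · S`. -/
def coneOver {E : Type*} [NormedAddCommGroup E] [NormedSpace ℝ E] (S : Set E) : Set E :=
  {y | ∃ t : ℝ, 0 < t ∧ ∃ x ∈ S, y = t • x}

/-- The level set `{p ∈ U | h(p) = 1}`. -/
def unitLevelSet {E : Type*} (h : E → ℝ) (U : Set E) : Set E :=
  {p ∈ U | h p = 1}

/-- The Hessian of `h` at `p` as a bilinear form. -/
def hessianForm {E : Type*} [NormedAddCommGroup E] [NormedSpace ℝ E]
    (h : E → ℝ) (p : E) : LinearMap.BilinForm ℝ E :=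
  LinearMap.mk₂ ℝ (fun v w => fderiv ℝ (fderiv ℝ h) p v w)
    (by intros; simp) (by intros; simp) (by intros; simp) (by intros; simp)

/-- `h` is homogeneous of degree `k` on `V`, in the sense of Euler's equation. -/
def IsHomogeneousOn {E : Type*} [NormedAddCommGroup E] [NormedSpace ℝ E]
    (h : E → ℝ) (V : Set E) (k : ℝ) : Prop :=
  ∀ x ∈ V, fderiv ℝ h x x = k * h x

/-- `U` is an open cone in `V` whose closure is contained in `V` up to the origin and in which the
level set `{h = 1}` is a Euclidean complete connected (in particular nonempty) hyperbolic
centroaffine hypersurface. -/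
structure IsAdmissibleCone {E : Type*} [NormedAddCommGroup E] [NormedSpace ℝ E]
    (V : Set E) (h : E → ℝ) (U : Set E) : Prop where
  isOpen : IsOpen U
  isCone : IsCone U
  subset : U ⊆ V
  closure_subset : closure U \ {0} ⊆ V
  connected : IsConnected (unitLevelSet h U)
  hyperbolic : IsHyperbolicCentroaffine (unitLevelSet h U)
  complete : IsEuclideanComplete (unitLevelSet h U)

/-- Regular boundary behaviour of the hypersurface `S`, a level set of `h`. With
`C = ℝ^{>0} · S`: the differential `dh` vanishes nowhere on `∂C \ {0}`, and `-∇̃²h` is positive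
semidefinite with one-dimensional kernel on the tangent spaces of `∂C \ {0}`. -/
def HasRegularBoundary {E : Type*} [NormedAddCommGroup E] [NormedSpace ℝ E]
    (h : E → ℝ) (S : Set E) : Prop :=
  ∀ p ∈ frontier (coneOver S) \ {0},
    fderiv ℝ h p ≠ 0 ∧
    (∀ v ∈ tangentSpaceAt (frontier (coneOver S) \ {0}) p, 0 ≤ -(hessianForm h p v v)) ∧
    Module.finrank ℝ (LinearMap.ker
      ((-hessianForm h p).restrict (tangentSpaceAt (frontier (coneOver S) \ {0}) p))) = 1

/-- The set `𝓕(V, k)` of smooth homogeneous functions of degree `k` on `V` with a Euclidean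
complete connected hyperbolic level set `{h = 1}` in some open cone. -/
def hyperbolicFunctions {E : Type*} [NormedAddCommGroup E] [NormedSpace ℝ E]
    (V : TopologicalSpace.Opens E) (k : ℝ) : Set (SmoothFunctions V) :=
  {h | IsHomogeneousOn h.toFun V k ∧ ∃ U : Set E, IsAdmissibleCone V h.toFun U}

/-- The set `𝓕_reg(V, k)` of those functions in `𝓕(V, k)` for which some such level set has
regular boundary behaviour. -/
def regularHyperbolicFunctions {E : Type*} [NormedAddCommGroup E] [NormedSpace ℝ E]
    (V : TopologicalSpace.Opens E) (k : ℝ) : Set (SmoothFunctions V) :=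
  {h ∈ hyperbolicFunctions V k | ∃ U : Set E, IsAdmissibleCone V h.toFun U ∧
    HasRegularBoundary h.toFun (unitLevelSet h.toFun U)}

end

/-! ### Smooth homogeneous functions -/

section Homogeneous

variable {E : Type*} [NormedAddCommGroup E] [NormedSpace ℝ E]

/-! Write P for `posCone h U`, the cone over the level set. By Euler's identity x is
Hessian-orthogonal to ker dh_x, and applying dh to the Gauss equation turns hyperbolicity into: D²h
is negative definite on ker dh throughout P. Completeness amounts to P being relatively closed in
the set where h > 0 (`mem_posCone_of_isEuclideanComplete`, `isEuclideanComplete_of_isClosed`).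
Together with connectedness these make h^(1/k) concave and P convex (`convex_posCone`), and dh_p
positive on the closure of P without 0, for every p in P (`fderiv_pos_of_mem_closure`).

Density. Take p with h(p) = 1, put l = dh_p / k, and replace h by h - ε l^k with 0 < ε < 1, where
l^k is extended from the cone to V (`exists_extension`). Since l > 0 on the closed cone, the zeros
of the new function there satisfy h = ε l^k > 0, so the new boundary lies inside the open cone P.
There a direct computation shows that the new Hessian is nonpositive on the kernel of the new
differential, with at most the radial direction as null direction (`hess_sub_nonpos`); concavity of
h^(1/k) gives convexity of the new cone and nonvanishing of the differential (`convex_sub`,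
`regular_sub`). Let ε tend to 0.

Openness. Regular boundary behaviour makes D²h negative definite on some hyperplane at every nonzero
point of the closed cone, boundary included (`isNegOnHyperplane_of_hasRegularBoundary`). Unlike the
original condition, this one is open in D²h and does not mention the moving boundary. Conversely,
for a homogeneous function it gives back hyperbolicity where h > 0 and the semidefiniteness where h
= 0 (`exists_smul_eq`). So finitely many open conditions on the 2-jet over compact subsets of the
unit sphere suffice (`regular_sphericalCone`). They hold for h near its closed cone and persist for
nearby functions; that V is a cone allows passing from the sphere to whole rays. -/

/-- `h` is smooth and homogeneous of degree `k > 1` on the open set `V`. -/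
structure IsSmoothHomogeneous (V : Set E) (h : E → ℝ) (k : ℝ) : Prop where
  isOpen : IsOpen V
  smooth : ContDiffOn ℝ ∞ h V
  euler : IsHomogeneousOn h V k
  one_lt : 1 < k

namespace IsSmoothHomogeneous

variable {V : Set E} {h : E → ℝ} {k : ℝ} {x : E}

theorem pos (H : IsSmoothHomogeneous V h k) : 0 < k := one_pos.trans H.one_lt

theorem contDiffAt (H : IsSmoothHomogeneous V h k) (hx : x ∈ V) : ContDiffAt ℝ ∞ h x :=
  H.smooth.contDiffAt (H.isOpen.mem_nhds hx)

theorem differentiableAt (H : IsSmoothHomogeneous V h k) (hx : x ∈ V) : DifferentiableAt ℝ h x :=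
  (H.contDiffAt hx).differentiableAt (by simp)

theorem continuousAt (H : IsSmoothHomogeneous V h k) (hx : x ∈ V) : ContinuousAt h x :=
  (H.contDiffAt hx).continuousAt

theorem contDiffAt_fderiv (H : IsSmoothHomogeneous V h k) (hx : x ∈ V) :
    ContDiffAt ℝ ∞ (fderiv ℝ h) x :=
  (H.contDiffAt hx).fderiv_right (m := ∞) (by simp)

theorem differentiableAt_fderiv (H : IsSmoothHomogeneous V h k) (hx : x ∈ V) :
    DifferentiableAt ℝ (fderiv ℝ h) x :=
  (H.contDiffAt_fderiv hx).differentiableAt (by simp)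

theorem continuousAt_hess (H : IsSmoothHomogeneous V h k) (hx : x ∈ V) :
    ContinuousAt (fderiv ℝ (fderiv ℝ h)) x :=
  ((H.contDiffAt_fderiv hx).fderiv_right (m := ∞) (by simp)).continuousAt

theorem hess_comm (H : IsSmoothHomogeneous V h k) (hx : x ∈ V) (v w : E) :
    fderiv ℝ (fderiv ℝ h) x v w = fderiv ℝ (fderiv ℝ h) x w v :=
  ((H.contDiffAt hx).isSymmSndFDerivAt (by
    simp only [minSmoothness_of_isRCLikeNormedField]
    exact WithTop.coe_le_coe.2 (le_top : (2 : ℕ∞) ≤ ⊤))).eq v w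

/-- Derivative of Euler's identity `dh_y(y) = k h(y)` in the direction v. In particular x is
Hessian-orthogonal to ker dh_x, on which all later splittings rest. -/
theorem hess_self_left (H : IsSmoothHomogeneous V h k) (hx : x ∈ V) (v : E) :
    fderiv ℝ (fderiv ℝ h) x x v = (k - 1) * fderiv ℝ h x v := by
  have h1 : HasFDerivAt (fun y => fderiv ℝ h y y)
      ((fderiv ℝ h x).comp (ContinuousLinearMap.id ℝ E) + (fderiv ℝ (fderiv ℝ h) x).flip x) x :=
    (H.differentiableAt_fderiv hx).hasFDerivAt.clm_apply (hasFDerivAt_id x)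
  have h2 : HasFDerivAt (fun y => fderiv ℝ h y y) (k • fderiv ℝ h x) x := by
    refine ((H.differentiableAt hx).hasFDerivAt.const_smul k).congr_of_eventuallyEq ?_
    filter_upwards [H.isOpen.mem_nhds hx] with y hy
    simpa using H.euler y hy
  have h3 := congrArg (fun L : E →L[ℝ] ℝ => L v) (h1.unique h2)
  simp at h3
  rw [H.hess_comm hx]
  linarith

theorem hess_self (H : IsSmoothHomogeneous V h k) (hx : x ∈ V) :
    fderiv ℝ (fderiv ℝ h) x x x = (k - 1) * k * h x := by
  rw [H.hess_self_left hx, H.euler x hx]; ring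

/-- The function t ↦ t^(-k) h(t x) has zero derivative. Only the ray of x has to lie in V, which
need not be a cone. -/
theorem homog (H : IsSmoothHomogeneous V h k) (hx : ∀ t : ℝ, 0 < t → t • x ∈ V) {t : ℝ}
    (ht : 0 < t) : h (t • x) = t ^ k * h x := by
  have key : ∀ s ∈ Ioi (0 : ℝ), HasDerivAt (fun s : ℝ => s ^ (-k) * h (s • x)) 0 s := by
    intro s hs
    have hs : 0 < s := hs
    have h1 : HasDerivAt (fun s : ℝ => s ^ (-k)) (-k * s ^ (-k - 1)) s :=
      Real.hasDerivAt_rpow_const (Or.inl hs.ne')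
    have h2 : HasDerivAt (fun s : ℝ => s • x) x s := by
      simpa using (hasDerivAt_id s).smul_const x
    have h3 := (H.differentiableAt (hx s hs)).hasFDerivAt.comp_hasDerivAt s h2
    have h4 := h1.mul h3
    have h5 : fderiv ℝ h (s • x) x = s⁻¹ * (k * h (s • x)) := by
      rw [← H.euler _ (hx s hs), map_smul, smul_eq_mul, inv_mul_cancel_left₀ hs.ne']
    refine h4.congr_deriv ?_
    rw [h5, Real.rpow_sub_one hs.ne', Function.comp]
    field_simp
    ring
  have hcd := (convex_Ioi (0 : ℝ)).is_const_of_fderivWithin_eq_zero (𝕜 := ℝ)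
    (f := fun s : ℝ => s ^ (-k) * h (s • x))
    (fun s hs => (key s hs).differentiableAt.differentiableWithinAt)
    (fun s hs => by
      have := ((key s hs).hasFDerivAt.hasFDerivWithinAt (s := Ioi 0)).fderivWithin
        (isOpen_Ioi.uniqueDiffWithinAt hs)
      rw [this]; ext; simp)
    (mem_Ioi.2 ht) (mem_Ioi.2 one_pos)
  simp only [Real.one_rpow, one_smul, one_mul] at hcd
  rw [← hcd, ← mul_assoc, ← Real.rpow_add ht]
  simp

theorem homog_of_mem_cone (H : IsSmoothHomogeneous V h k) {C : Set E} (hC : IsCone C)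
    (hCV : C ⊆ V) (hx : x ∈ C) {t : ℝ} (ht : 0 < t) : h (t • x) = t ^ k * h x :=
  H.homog (fun s hs => hCV (hC s hs x hx)) ht

theorem fderiv_smul (H : IsSmoothHomogeneous V h k) {C : Set E} (hCo : IsOpen C) (hC : IsCone C)
    (hCV : C ⊆ V) (hx : x ∈ C) {t : ℝ} (ht : 0 < t) :
    t • fderiv ℝ h (t • x) = t ^ k • fderiv ℝ h x := by
  rw [← fderiv_comp_smul]
  have : (fun y => h (t • y)) =ᶠ[𝓝 x] fun y => t ^ k • h y := by
    filter_upwards [hCo.mem_nhds hx] with y hy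
    simpa using H.homog_of_mem_cone hC hCV hy ht
  rw [this.fderiv_eq, fderiv_fun_const_smul (H.differentiableAt (hCV hx))]

theorem hess_smul (H : IsSmoothHomogeneous V h k) {C : Set E} (hCo : IsOpen C) (hC : IsCone C)
    (hCV : C ⊆ V) (hx : x ∈ C) {t : ℝ} (ht : 0 < t) :
    t • t • fderiv ℝ (fderiv ℝ h) (t • x) = t ^ k • fderiv ℝ (fderiv ℝ h) x := by
  have : (fun y => t • fderiv ℝ h (t • y)) =ᶠ[𝓝 x] fun y => t ^ k • fderiv ℝ h y := by
    filter_upwards [hCo.mem_nhds hx] with y hy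
    exact H.fderiv_smul hCo hC hCV hy ht
  have h2 := this.fderiv_eq (𝕜 := ℝ)
  have hd : DifferentiableAt ℝ (fun y => fderiv ℝ h (t • y)) x :=
    DifferentiableAt.comp x (H.differentiableAt_fderiv (hCV (hC t ht x hx)))
      (differentiableAt_id.const_smul t)
  rw [fderiv_fun_const_smul (H.differentiableAt_fderiv (hCV hx)), fderiv_fun_const_smul hd,
    fderiv_comp_smul (f := fderiv ℝ h)] at h2
  exact h2

/-- The part of `v` in the kernel of `dh_x`, in the splitting `ker dh_x ⊕ ℝ x`. -/
theorem hess_decomp (H : IsSmoothHomogeneous V h k) (hx : x ∈ V) (h0 : h x ≠ 0) (v : E) :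
    fderiv ℝ h x (v - (fderiv ℝ h x v / (k * h x)) • x) = 0 ∧
    fderiv ℝ (fderiv ℝ h) x v v =
      fderiv ℝ (fderiv ℝ h) x (v - (fderiv ℝ h x v / (k * h x)) • x)
        (v - (fderiv ℝ h x v / (k * h x)) • x) +
      (k - 1) / k * (fderiv ℝ h x v) ^ 2 / h x := by
  have hk := H.pos.ne'
  have h1 := H.hess_self_left hx
  have h2 := H.hess_self hx
  have h3 := H.hess_comm hx v x
  have h4 := H.euler x hx
  constructor
  · rw [map_sub, map_smul, h4, smul_eq_mul]; field_simp; ring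
  · simp only [map_sub, map_smul, sub_apply, smul_apply,
      smul_eq_mul, h3, h1, h4]
    field_simp
    ring

end IsSmoothHomogeneous

end Homogeneous
/-! ### Level sets and tangent spaces -/

/-- The part of `U` where `h` is positive. -/
def posCone {E : Type*} (h : E → ℝ) (U : Set E) : Set E := {x ∈ U | 0 < h x}

theorem unitLevelSet_subset {E : Type*} {h : E → ℝ} {U : Set E} :
    unitLevelSet h U ⊆ posCone h U :=
  fun x hx => ⟨hx.1, by rw [hx.2]; exact one_pos⟩

section LevelSets

variable {E : Type*} [NormedAddCommGroup E] [NormedSpace ℝ E]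

/-- The projection along the rays to the level set `{h = 1}`, for `h` homogeneous of degree `k`. -/
noncomputable def radialProj (h : E → ℝ) (k : ℝ) (x : E) : E := (h x) ^ (-(1 / k)) • x

theorem IsCurveIn.contDiffAt {S : Set E} {p : E} {γ : ℝ → E} (hγ : IsCurveIn S p γ) :
    ContDiffAt ℝ ∞ γ 0 := by
  obtain ⟨-, δ, hδ, h1, -⟩ := hγ
  exact h1.contDiffAt (Ioo_mem_nhds (by linarith) hδ)

theorem IsCurveIn.eventually_mem {S : Set E} {p : E} {γ : ℝ → E} (hγ : IsCurveIn S p γ) :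
    ∀ᶠ t in 𝓝 0, γ t ∈ S := by
  obtain ⟨-, δ, hδ, -, h1⟩ := hγ
  filter_upwards [Ioo_mem_nhds (by linarith : -δ < 0) hδ] with t ht using h1 ht

namespace IsSmoothHomogeneous

variable {V U S : Set E} {h : E → ℝ} {k c : ℝ} {p x : E} {γ : ℝ → E}

theorem fderiv_velocity (H : IsSmoothHomogeneous V h k) (hS : ∀ y ∈ S, h y = c) (hp : p ∈ V)
    (hγ : IsCurveIn S p γ) : fderiv ℝ h p (deriv γ 0) = 0 := by
  have h0 : γ 0 = p := hγ.1
  have h1 : HasDerivAt γ (deriv γ 0) 0 :=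
    (hγ.contDiffAt.differentiableAt (by simp)).hasDerivAt
  have h2 : HasDerivAt (h ∘ γ) (fderiv ℝ h p (deriv γ 0)) 0 := by
    rw [← h0] at hp ⊢
    exact (H.differentiableAt hp).hasFDerivAt.comp_hasDerivAt 0 h1
  have h3 : h ∘ γ =ᶠ[𝓝 0] fun _ => c := by
    filter_upwards [hγ.eventually_mem] with t ht using hS _ ht
  exact h2.unique ((hasDerivAt_const (0 : ℝ) c).congr_of_eventuallyEq h3)

theorem tangentSpaceAt_le_ker (H : IsSmoothHomogeneous V h k) (hS : ∀ y ∈ S, h y = c)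
    (hp : p ∈ V) {v : E} (hv : v ∈ tangentSpaceAt S p) : fderiv ℝ h p v = 0 := by
  have : tangentSpaceAt S p ≤ LinearMap.ker (fderiv ℝ h p : E →ₗ[ℝ] ℝ) := by
    refine Submodule.span_le.2 ?_
    rintro _ ⟨γ, hγ, rfl⟩
    exact H.fderiv_velocity hS hp hγ
  exact this hv

/-- Second derivative at 0 of the constant function h ∘ γ. -/
theorem hess_velocity (H : IsSmoothHomogeneous V h k) (hS : ∀ y ∈ S, h y = c) (hSV : S ⊆ V)
    (hp : p ∈ V) (hγ : IsCurveIn S p γ) :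
    fderiv ℝ (fderiv ℝ h) p (deriv γ 0) (deriv γ 0) + fderiv ℝ h p (deriv (deriv γ) 0) = 0 := by
  have h0 : γ 0 = p := hγ.1
  have hc := hγ.contDiffAt
  have h1 : HasDerivAt γ (deriv γ 0) 0 := (hc.differentiableAt (by simp)).hasDerivAt
  have h1' : HasDerivAt (deriv γ) (deriv (deriv γ) 0) 0 := by
    have : ContDiffAt ℝ ∞ (deriv γ) 0 := by
      have h5 : ContDiffAt ℝ ∞ (fun t => fderiv ℝ γ t 1) 0 :=
        (hc.fderiv_right (m := ∞) (by simp)).clm_apply contDiffAt_const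
      exact h5
    exact (this.differentiableAt (by simp)).hasDerivAt
  have h2 : HasDerivAt (fun t => fderiv ℝ h (γ t) (deriv γ t))
      (fderiv ℝ (fderiv ℝ h) p (deriv γ 0) (deriv γ 0) +
        fderiv ℝ h p (deriv (deriv γ) 0)) 0 := by
    rw [← h0] at hp ⊢
    exact ((H.differentiableAt_fderiv hp).hasFDerivAt.comp_hasDerivAt 0 h1).clm_apply h1'
  have h3 : (fun t => fderiv ℝ h (γ t) (deriv γ t)) =ᶠ[𝓝 0] fun _ => 0 := by
    obtain ⟨-, δ, hδ, hs, hm⟩ := hγ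
    filter_upwards [Ioo_mem_nhds (by linarith : -δ < 0) hδ] with t ht
    have ht' := isOpen_Ioo.mem_nhds ht
    have h4 : HasDerivAt γ (deriv γ t) t :=
      ((hs.contDiffAt ht').differentiableAt (by simp)).hasDerivAt
    have h5 := (H.differentiableAt (hSV (hm ht))).hasFDerivAt.comp_hasDerivAt t h4
    have h6 : h ∘ γ =ᶠ[𝓝 t] fun _ => c := by
      filter_upwards [ht'] with s hs using hS _ (hm hs)
    exact h5.unique ((hasDerivAt_const t c).congr_of_eventuallyEq h6)
  exact h2.unique ((hasDerivAt_const (0 : ℝ) (0 : ℝ)).congr_of_eventuallyEq h3)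

theorem contDiffAt_radialProj (H : IsSmoothHomogeneous V h k) (hx : x ∈ V) (h0 : 0 < h x) :
    ContDiffAt ℝ ∞ (radialProj h k) x :=
  ((H.contDiffAt hx).rpow_const_of_ne h0.ne').smul contDiffAt_id

theorem rpow_mul_eq_one (H : IsSmoothHomogeneous V h k) {a : ℝ} (ha : 0 < a) :
    (a ^ (-(1 / k))) ^ k * a = 1 := by
  rw [← Real.rpow_mul ha.le, neg_mul, one_div, inv_mul_cancel₀ H.pos.ne', Real.rpow_neg_one,
    inv_mul_cancel₀ ha.ne']

theorem radialProj_mem (H : IsSmoothHomogeneous V h k) (hU : IsCone U) (hUV : U ⊆ V)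
    (hx : x ∈ posCone h U) : radialProj h k x ∈ unitLevelSet h U := by
  have ht : 0 < h x ^ (-(1 / k)) := Real.rpow_pos_of_pos hx.2 _
  refine ⟨hU _ ht _ hx.1, ?_⟩
  rw [radialProj, H.homog_of_mem_cone hU hUV hx.1 ht, H.rpow_mul_eq_one hx.2]

theorem isOpen_posCone (H : IsSmoothHomogeneous V h k) (hUo : IsOpen U) (hUV : U ⊆ V) :
    IsOpen (posCone h U) := by
  rw [isOpen_iff_mem_nhds]
  intro x hx
  filter_upwards [hUo.mem_nhds hx.1,
    (H.continuousAt (hUV hx.1)).eventually (lt_mem_nhds hx.2)] with y h1 h2 using ⟨h1, h2⟩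

theorem isCone_posCone (H : IsSmoothHomogeneous V h k) (hU : IsCone U) (hUV : U ⊆ V) :
    IsCone (posCone h U) := by
  intro t ht x hx
  refine ⟨hU t ht x hx.1, ?_⟩
  rw [H.homog_of_mem_cone hU hUV hx.1 ht]
  exact mul_pos (Real.rpow_pos_of_pos ht _) hx.2

/-- This identifies the cone U₀ of the statement with `posCone h U`, which replaces it from here on.
-/
theorem coneOver_unitLevelSet (H : IsSmoothHomogeneous V h k) (hU : IsCone U) (hUV : U ⊆ V) :
    coneOver (unitLevelSet h U) = posCone h U := by
  ext x
  constructor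
  · rintro ⟨t, ht, y, hy, rfl⟩
    exact H.isCone_posCone hU hUV t ht y (unitLevelSet_subset hy)
  · intro hx
    have ht : 0 < h x ^ (-(1 / k)) := Real.rpow_pos_of_pos hx.2 _
    exact ⟨(h x ^ (-(1 / k)))⁻¹, inv_pos.2 ht, _, H.radialProj_mem hU hUV hx,
      (inv_smul_smul₀ ht.ne' x).symm⟩

theorem zero_notMem_posCone (H : IsSmoothHomogeneous V h k) (hUV : U ⊆ V) :
    (0 : E) ∉ posCone h U := by
  intro h0
  have := H.euler 0 (hUV h0.1)
  rw [map_zero] at this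
  have h1 := h0.2
  have := H.pos
  nlinarith

/-- Every vector in the kernel of `dh` is the velocity of a smooth curve in the level set. -/
theorem exists_curve (H : IsSmoothHomogeneous V h k) (hUo : IsOpen U) (hU : IsCone U)
    (hUV : U ⊆ V) (hp : p ∈ unitLevelSet h U) {v : E} (hv : fderiv ℝ h p v = 0) :
    ∃ γ, IsCurveIn (unitLevelSet h U) p γ ∧ deriv γ 0 = v := by
  have hline : Continuous fun t : ℝ => p + t • v := by fun_prop
  obtain ⟨δ, hδ, hb⟩ := Metric.mem_nhds_iff.1 (hline.continuousAt.preimage_mem_nhds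
    (by simpa using (H.isOpen_posCone hUo hUV).mem_nhds (unitLevelSet_subset hp)) :
      _ ∈ 𝓝 (0 : ℝ))
  rw [Real.ball_eq_Ioo, zero_sub, zero_add] at hb
  -- The line p + t v is pushed radially into the level set. As dh_p(v) = 0, the radial factor is
  -- stationary at t = 0 and the velocity stays v.
  refine ⟨fun t => radialProj h k (p + t • v), ⟨?_, δ, hδ, ?_, ?_⟩, ?_⟩
  · simp [radialProj, hp.2]
  · intro t ht
    have h1 := hb ht
    have hl : ContDiffAt ℝ ∞ (fun t : ℝ => p + t • v) t := by fun_prop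
    exact ((H.contDiffAt_radialProj (hUV h1.1) h1.2).comp t hl).contDiffWithinAt
  · intro t ht
    exact H.radialProj_mem hU hUV (hb ht)
  · have h1 : HasDerivAt (fun t : ℝ => p + t • v) v 0 := by
      simpa using ((hasDerivAt_id (0 : ℝ)).smul_const v).const_add p
    have h2 : HasDerivAt (fun t : ℝ => h (p + t • v)) 0 0 := by
      have hd : HasFDerivAt h (fderiv ℝ h p) (p + (0 : ℝ) • v) := by
        simpa using (H.differentiableAt (hUV hp.1)).hasFDerivAt
      simpa only [hv] using! hd.comp_hasDerivAt 0 h1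
    have h3 := (h2.rpow_const (p := -(1 / k)) (by simp [hp.2])).smul h1
    exact h3.deriv.trans (by simp [hp.2])

theorem mem_tangentSpaceAt_iff (H : IsSmoothHomogeneous V h k) (hUo : IsOpen U) (hU : IsCone U)
    (hUV : U ⊆ V) (hp : p ∈ unitLevelSet h U) {v : E} :
    v ∈ tangentSpaceAt (unitLevelSet h U) p ↔ fderiv ℝ h p v = 0 :=
  ⟨H.tangentSpaceAt_le_ker (c := 1) (fun _ hy => hy.2) (hUV hp.1), fun hv =>
    Submodule.subset_span (H.exists_curve hUo hU hUV hp hv)⟩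

/-- Applying dh to the Gauss equation, with dh_p(p) = k on the level set, leaves c = -D²h(γ', γ') /
k. So positivity of the centroaffine metric is negativity of D²h on ker dh. -/
theorem isHyperbolicCentroaffine (H : IsSmoothHomogeneous V h k) (hUo : IsOpen U) (hU : IsCone U)
    (hUV : U ⊆ V) (hneg : ∀ x ∈ posCone h U, ∀ v, v ≠ 0 → fderiv ℝ h x v = 0 →
      fderiv ℝ (fderiv ℝ h) x v v < 0) : IsHyperbolicCentroaffine (unitLevelSet h U) := by
  have hmem := fun {p} hp {v} => H.mem_tangentSpaceAt_iff (p := p) hUo hU hUV hp (v := v)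
  refine ⟨⟨fun p hp => ⟨posCone h U, fun x => h x - 1, H.isOpen_posCone hUo hUV,
    unitLevelSet_subset hp, ?_, ?_, ?_⟩, ?_⟩, ?_⟩
  · exact (H.smooth.mono fun x hx => hUV hx.1).sub contDiffOn_const
  · intro x hx h0
    rw [fderiv_sub_const] at h0
    have := H.euler x (hUV hx.1)
    rw [h0] at this
    exact (mul_pos H.pos hx.2).ne this
  · ext x
    constructor
    · exact fun hx => ⟨hx.2, by simp [hx.1.2]⟩
    · exact fun hx => ⟨⟨hx.1.1, by have := hx.2; simp only at this; linarith⟩, hx.1⟩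
  · intro p hp hpT
    rw [hmem hp, H.euler p (hUV hp.1), hp.2] at hpT
    linarith [H.pos]
  · intro p hp γ hγ hv
    have h1 := H.fderiv_velocity (c := 1) (fun y hy => hy.2) (hUV hp.1) hγ
    have h2 := H.hess_velocity (c := 1) (fun y hy => hy.2) (fun y hy => hUV hy.1) (hUV hp.1) hγ
    have h3 := hneg p (unitLevelSet_subset hp) _ hv h1
    refine ⟨-(fderiv ℝ (fderiv ℝ h) p (deriv γ 0) (deriv γ 0)) / k,
      div_pos (by linarith) H.pos, ?_⟩
    rw [IsGaussCoefficient, hγ.1, hmem hp, map_sub, map_smul, H.euler p (hUV hp.1), hp.2,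
      smul_eq_mul]
    field_simp [H.pos.ne']
    linarith

theorem hess_neg_of_isHyperbolicCentroaffine (H : IsSmoothHomogeneous V h k) (hUo : IsOpen U)
    (hU : IsCone U) (hUV : U ⊆ V) (hS : IsHyperbolicCentroaffine (unitLevelSet h U)) :
    ∀ x ∈ posCone h U, ∀ v, v ≠ 0 → fderiv ℝ h x v = 0 →
      fderiv ℝ (fderiv ℝ h) x v v < 0 := by
  have key : ∀ p ∈ unitLevelSet h U, ∀ v, v ≠ 0 → fderiv ℝ h p v = 0 →
      fderiv ℝ (fderiv ℝ h) p v v < 0 := by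
    intro p hp v hv0 hv
    obtain ⟨γ, hγ, rfl⟩ := H.exists_curve hUo hU hUV hp hv
    obtain ⟨c, hc, hg⟩ := hS.2 p hp γ hγ hv0
    have h2 := H.hess_velocity (c := 1) (fun y hy => hy.2) (fun y hy => hUV hy.1) (hUV hp.1) hγ
    rw [IsGaussCoefficient, hγ.1, H.mem_tangentSpaceAt_iff hUo hU hUV hp, map_sub, map_smul,
      H.euler p (hUV hp.1), hp.2, smul_eq_mul] at hg
    nlinarith [mul_pos hc H.pos]
  -- A general point of the cone is reduced to its radial projection: dh and D²h scale by positive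
  -- factors along the ray.
  intro x hx v hv0 hv
  have ht : 0 < h x ^ (-(1 / k)) := Real.rpow_pos_of_pos hx.2 _
  have hp := H.radialProj_mem hU hUV hx
  rw [radialProj] at hp
  set t := h x ^ (-(1 / k))
  have h1 := congrArg (fun L : E →L[ℝ] ℝ => L v) (H.fderiv_smul hUo hU hUV hx.1 ht)
  have h2 := congrArg (fun L : E →L[ℝ] E →L[ℝ] ℝ => L v v) (H.hess_smul hUo hU hUV hx.1 ht)
  simp only [smul_apply, smul_eq_mul, hv, mul_zero, mul_eq_zero, ht.ne', false_or] at h1 h2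
  have h3 := key _ hp v hv0 h1
  have h4 := Real.rpow_pos_of_pos ht k
  by_contra h5
  push Not at h5
  nlinarith [mul_nonneg h4.le h5, mul_pos ht ht]

end IsSmoothHomogeneous

end LevelSets
/-! ### Euclidean completeness -/

section Completeness

variable {E : Type*} [NormedAddCommGroup E] [NormedSpace ℝ E]

theorem edist_le_inducedEDist [CompleteSpace E] (S : Set E) (x y : E) :
    edist x y ≤ inducedEDist S x y := by
  refine le_iInf₂ ?_
  rintro γ ⟨h1, -, rfl, rfl⟩
  rw [edist_comm, edist_eq_enorm_sub]
  exact enorm_sub_le_lintegral_derivWithin_Icc_of_contDiffOn_Icc h1 zero_le_one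

namespace IsSmoothHomogeneous

variable {V U : Set E} {h : E → ℝ} {k : ℝ}

/-- The projected segment is an admissible curve in the level set. This is the way to bound the
intrinsic distance from above by the Euclidean one. -/
theorem inducedEDist_radialProj_le (H : IsSmoothHomogeneous V h k) (hU : IsCone U) (hUV : U ⊆ V)
    {z₁ z₂ : E} {L : ℝ} (hseg : segment ℝ z₁ z₂ ⊆ posCone h U)
    (hL : ∀ z ∈ segment ℝ z₁ z₂, ‖fderiv ℝ (radialProj h k) z‖ ≤ L) :
    inducedEDist (unitLevelSet h U) (radialProj h k z₁) (radialProj h k z₂) ≤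
      ENNReal.ofReal (L * ‖z₁ - z₂‖) := by
  have hmem : ∀ t ∈ Icc (0 : ℝ) 1, AffineMap.lineMap z₁ z₂ t ∈ segment ℝ z₁ z₂ := fun t ht => by
    rw [segment_eq_image_lineMap]; exact mem_image_of_mem _ ht
  have hder : ∀ t ∈ Icc (0 : ℝ) 1, HasDerivAt
      (fun t : ℝ => radialProj h k (AffineMap.lineMap z₁ z₂ t))
      (fderiv ℝ (radialProj h k) (AffineMap.lineMap z₁ z₂ t) (z₂ - z₁)) t := by
    intro t ht
    have hm := hseg (hmem t ht)
    exact ((H.contDiffAt_radialProj (hUV hm.1) hm.2).differentiableAt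
      (by simp)).hasFDerivAt.comp_hasDerivAt t AffineMap.hasDerivAt_lineMap
  refine (iInf₂_le (fun t : ℝ => radialProj h k (AffineMap.lineMap z₁ z₂ t))
    (⟨?_, ?_, by simp, by simp⟩ : _ ∧ _ ∧ _ ∧ _)).trans ?_
  · intro t ht
    have hm := hseg (hmem t ht)
    have hl : ContDiff ℝ ∞ fun t : ℝ => AffineMap.lineMap (k := ℝ) z₁ z₂ t := by
      simp only [AffineMap.lineMap_apply, vsub_eq_sub, vadd_eq_add]; fun_prop
    exact (((H.contDiffAt_radialProj (hUV hm.1) hm.2).comp t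
      hl.contDiffAt).of_le (by simp)).contDiffWithinAt
  · intro t ht
    exact H.radialProj_mem hU hUV (hseg (hmem t ht))
  · calc ∫⁻ t in Icc (0 : ℝ) 1, ‖derivWithin
          (fun t : ℝ => radialProj h k (AffineMap.lineMap z₁ z₂ t)) (Icc 0 1) t‖ₑ
        ≤ ∫⁻ _ in Icc (0 : ℝ) 1, ENNReal.ofReal (L * ‖z₁ - z₂‖) := by
          refine MeasureTheory.setLIntegral_mono measurable_const fun t ht => ?_
          rw [((hder t ht).hasDerivWithinAt).derivWithin
            (uniqueDiffOn_Icc zero_lt_one t ht), ← ofReal_norm]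
          refine ENNReal.ofReal_le_ofReal ((ContinuousLinearMap.le_opNorm _ _).trans ?_)
          rw [norm_sub_rev]
          exact mul_le_mul_of_nonneg_right (hL _ (hmem t ht)) (norm_nonneg _)
      _ = ENNReal.ofReal (L * ‖z₁ - z₂‖) := by simp

theorem exists_ball_radialProj (H : IsSmoothHomogeneous V h k) {q : E} (hq : q ∈ V)
    (h0 : 0 < h q) : ∃ r > 0, ∃ L : ℝ, Metric.ball q r ⊆ posCone h V ∧
      ∀ z ∈ Metric.ball q r, ‖fderiv ℝ (radialProj h k) z‖ ≤ L := by
  have hc := ((H.contDiffAt_radialProj hq h0).fderiv_right (m := ∞) (by simp)).continuousAt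
  have h1 := hc.norm.eventually (gt_mem_nhds (lt_add_one _))
  have h2 := (H.isOpen_posCone H.isOpen Subset.rfl).mem_nhds ⟨hq, h0⟩
  obtain ⟨r, hr, hb⟩ := Metric.mem_nhds_iff.1 (inter_mem h2 h1)
  exact ⟨r, hr, _, fun z hz => (hb hz).1, fun z hz => (hb hz).2.le⟩

/-- If q were missing, follow the segment from a nearby p in the cone towards q up to its first exit
time s. Radial projection is Lipschitz near q, so the projections of the points before s form an
intrinsic Cauchy sequence. By completeness its limit, the projection of the exit point, lies in the
level set, and hence the exit point lies in the cone. -/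
theorem mem_posCone_of_isEuclideanComplete [CompleteSpace E] (H : IsSmoothHomogeneous V h k)
    (hUo : IsOpen U) (hU : IsCone U) (hUV : U ⊆ V)
    (hS : IsEuclideanComplete (unitLevelSet h U)) {q : E} (hq : q ∈ V) (h0 : 0 < h q)
    (hqc : q ∈ closure (posCone h U)) : q ∈ posCone h U := by
  obtain ⟨r, hr, L, hb, hL⟩ := H.exists_ball_radialProj hq h0
  obtain ⟨p, hpP, hpr⟩ := Metric.mem_closure_iff.1 hqc r hr
  by_contra hqP
  have hPo := H.isOpen_posCone hUo hUV
  set z : ℝ → E := fun t => AffineMap.lineMap p q t with hz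
  have hzc : Continuous z := AffineMap.lineMap_continuous
  have hzr : ∀ t ∈ Icc (0 : ℝ) 1, z t ∈ Metric.ball q r := by
    intro t ht
    refine (convex_ball q r).segment_subset (x := p) (y := q) ?_ (Metric.mem_ball_self hr) ?_
    · rwa [Metric.mem_ball, dist_comm]
    · rw [segment_eq_image_lineMap]; exact mem_image_of_mem _ ht
  set T : Set ℝ := Icc 0 1 ∩ z ⁻¹' (posCone h U)ᶜ with hT
  have hTc : IsCompact T := isCompact_Icc.inter_right (hPo.isClosed_compl.preimage hzc)
  have hTn : T.Nonempty := ⟨1, by simp, by simpa [hz] using hqP⟩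
  obtain ⟨⟨hs0, hs1⟩, hsP⟩ := hTc.sInf_mem hTn
  set s := sInf T
  have hlt : ∀ t, 0 ≤ t → t < s → z t ∈ posCone h U := by
    intro t ht0 hts
    by_contra hcon
    have htT : t ∈ T := ⟨⟨ht0, (hts.trans_le hs1).le⟩, hcon⟩
    exact (csInf_le ⟨0, fun a ha => ha.1.1⟩ htT).not_gt hts
  have hspos : 0 < s := by
    refine hs0.lt_of_ne fun hh => hsP ?_
    rw [← hh]; simpa [hz] using hpP
  -- Parameters in [0, s) tending to the exit time s.
  set t : ℕ → ℝ := fun i => s * (1 - 1 / ((i : ℝ) + 1)) with ht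
  have ht01 : ∀ i, 0 ≤ t i ∧ t i < s := by
    intro i
    have h1 : 0 < 1 / ((i : ℝ) + 1) := by positivity
    have h2 : 1 / ((i : ℝ) + 1) ≤ 1 := by
      rw [div_le_one (by positivity)]; linarith [(Nat.cast_nonneg i : (0 : ℝ) ≤ i)]
    exact ⟨mul_nonneg hs0 (by linarith), by simp only [ht]; nlinarith⟩
  have httend : Tendsto t atTop (𝓝 s) := by
    have := (tendsto_one_div_add_atTop_nhds_zero_nat (𝕜 := ℝ)).const_sub 1 |>.const_mul s
    simpa [ht] using this
  have hztend : Tendsto (fun i => z (t i)) atTop (𝓝 (z s)) := (hzc.tendsto s).comp httend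
  have hdist : ∀ i j, inducedEDist (unitLevelSet h U) (radialProj h k (z (t i)))
      (radialProj h k (z (t j))) ≤ ENNReal.ofReal (L * ‖z (t i) - z (t j)‖) := by
    intro i j
    have hseg : ∀ y ∈ segment ℝ (z (t i)) (z (t j)), y ∈ posCone h U ∧ y ∈ Metric.ball q r := by
      intro y hy
      have hy' : y ∈ z '' segment ℝ (t i) (t j) := by
        rw [hz]
        have := image_segment ℝ ((AffineMap.lineMap p q : ℝ →ᵃ[ℝ] E)) (t i) (t j)
        rw [this]; exact hy
      obtain ⟨a, ha, rfl⟩ := hy'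
      have ha' := (convex_Ico (0 : ℝ) s).segment_subset (ht01 i) (ht01 j) ha
      exact ⟨hlt a ha'.1 ha'.2, hzr a ⟨ha'.1, ha'.2.le.trans hs1⟩⟩
    exact H.inducedEDist_radialProj_le hU hUV (fun y hy => (hseg y hy).1)
      fun y hy => hL y (hseg y hy).2
  obtain ⟨x, hx, hxt⟩ := hS (fun i => radialProj h k (z (t i)))
    (fun i => H.radialProj_mem hU hUV (hlt _ (ht01 i).1 (ht01 i).2)) (by
      intro ε hε
      have h1 : Tendsto (fun m : ℕ × ℕ => ENNReal.ofReal (L * ‖z (t m.1) - z (t m.2)‖))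
          (atTop ×ˢ atTop) (𝓝 0) := by
        have h2 := ((hztend.comp tendsto_fst).sub (hztend.comp tendsto_snd)).norm.const_mul L
          |> (ENNReal.tendsto_ofReal ·)
        simpa using! h2
      rw [prod_atTop_atTop_eq] at h1
      obtain ⟨N, hN⟩ := eventually_atTop_prod_self'.1 (h1.eventually (gt_mem_nhds hε))
      exact ⟨N, fun i hi j hj => (hdist i j).trans_lt (hN i hi j hj)⟩)
  have hx1 : Tendsto (fun i => radialProj h k (z (t i))) atTop (𝓝 x) := by
    rw [tendsto_iff_edist_tendsto_0]
    exact tendsto_of_tendsto_of_tendsto_of_le_of_le tendsto_const_nhds hxt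
      (fun _ => zero_le) fun _ => edist_le_inducedEDist _ _ _
  have hzs := hb (hzr s ⟨hs0, hs1⟩)
  have hx2 : Tendsto (fun i => radialProj h k (z (t i))) atTop (𝓝 (radialProj h k (z s))) :=
    (H.contDiffAt_radialProj hzs.1 hzs.2).continuousAt.tendsto.comp hztend
  rw [tendsto_nhds_unique hx1 hx2, radialProj] at hx
  have hpos : 0 < h (z s) ^ (-(1 / k)) := Real.rpow_pos_of_pos hzs.2 _
  have := hU _ (inv_pos.2 hpos) _ hx.1
  rw [inv_smul_smul₀ hpos.ne'] at this
  exact hsP ⟨this, hzs.2⟩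

/-- An intrinsic Cauchy sequence is Euclidean Cauchy, so it has a limit in the closed level set.
Near that limit the radial projection, which fixes the level set, upgrades Euclidean to intrinsic
convergence. -/
theorem isEuclideanComplete_of_isClosed [CompleteSpace E] (H : IsSmoothHomogeneous V h k)
    (hUo : IsOpen U) (hU : IsCone U) (hUV : U ⊆ V) (hS : IsClosed (unitLevelSet h U)) :
    IsEuclideanComplete (unitLevelSet h U) := by
  intro u hu hcauchy
  have hc : CauchySeq u := by
    rw [EMetric.cauchySeq_iff]
    intro ε hε
    obtain ⟨N, hN⟩ := hcauchy ε hε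
    exact ⟨N, fun m hm n hn => (edist_le_inducedEDist _ _ _).trans_lt (hN m hm n hn)⟩
  obtain ⟨q, hq⟩ := cauchySeq_tendsto_of_complete hc
  have hqS : q ∈ unitLevelSet h U := hS.mem_of_tendsto hq (Eventually.of_forall hu)
  refine ⟨q, hqS, ?_⟩
  have hqP := unitLevelSet_subset hqS
  obtain ⟨r, hr, L, -, hL⟩ := H.exists_ball_radialProj (hUV hqP.1) hqP.2
  obtain ⟨r', hr', hb'⟩ := Metric.mem_nhds_iff.1 ((H.isOpen_posCone hUo hUV).mem_nhds hqP)
  have hfix : ∀ y ∈ unitLevelSet h U, radialProj h k y = y := fun y hy => by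
    simp [radialProj, hy.2]
  have hle : ∀ᶠ i in atTop, inducedEDist (unitLevelSet h U) (u i) q ≤
      ENNReal.ofReal (L * ‖u i - q‖) := by
    filter_upwards [hq.eventually (Metric.ball_mem_nhds q (lt_min hr hr'))] with i hi
    have hseg := (convex_ball q (min r r')).segment_subset hi
      (Metric.mem_ball_self (lt_min hr hr'))
    have := H.inducedEDist_radialProj_le hU hUV
      (fun y hy => hb' (Metric.ball_subset_ball (min_le_right _ _) (hseg hy)))
      (fun y hy => hL y (Metric.ball_subset_ball (min_le_left _ _) (hseg hy)))
    rwa [hfix _ (hu i), hfix _ hqS] at this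
  have h0 : Tendsto (fun i => ENNReal.ofReal (L * ‖u i - q‖)) atTop (𝓝 0) := by
    have := ENNReal.tendsto_ofReal ((hq.sub_const q).norm.const_mul L)
    simpa using this
  exact tendsto_of_tendsto_of_tendsto_of_le_of_le' tendsto_const_nhds h0
    (Eventually.of_forall fun _ => zero_le) hle

theorem exists_le_mul_norm_rpow [FiniteDimensional ℝ E] (H : IsSmoothHomogeneous V h k)
    (hU : IsCone U) (hUV : U ⊆ V) (hcl : closure U \ {0} ⊆ V) :
    ∃ M : ℝ, ∀ x ∈ U, x ≠ 0 → h x ≤ M * ‖x‖ ^ k := by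
  have hK : IsCompact (closure U ∩ Metric.sphere 0 1) :=
    (isCompact_sphere 0 1).inter_left isClosed_closure
  have hKV : closure U ∩ Metric.sphere 0 1 ⊆ V := fun x hx =>
    hcl ⟨hx.1, Metric.ne_of_mem_sphere hx.2 one_ne_zero⟩
  obtain ⟨M, hM⟩ := hK.bddAbove_image (H.smooth.continuousOn.mono hKV)
  refine ⟨M, fun x hx hx0 => ?_⟩
  have hn : 0 < ‖x‖ := norm_pos_iff.2 hx0
  have h1 := hM (mem_image_of_mem h (⟨subset_closure (hU _ (inv_pos.2 hn) x hx),
    by simp [norm_smul, hn.ne']⟩ : ‖x‖⁻¹ • x ∈ closure U ∩ Metric.sphere 0 1))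
  rw [H.homog_of_mem_cone hU hUV hx (inv_pos.2 hn), Real.inv_rpow hn.le] at h1
  rwa [inv_mul_le_iff₀ (Real.rpow_pos_of_pos hn _), mul_comm] at h1

/-- By homogeneity h is O(‖x‖^k) on U, hence small near 0. The origin is the only point of the
closure of U that may lie outside V, so superlevel sets have all their limit points in V. -/
theorem zero_notMem_closure [FiniteDimensional ℝ E] (H : IsSmoothHomogeneous V h k)
    (hU : IsCone U) (hUV : U ⊆ V) (hcl : closure U \ {0} ⊆ V) {c : ℝ} (hc : 0 < c) :
    (0 : E) ∉ closure {x ∈ posCone h U | c ≤ h x} := by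
  obtain ⟨M, hM⟩ := H.exists_le_mul_norm_rpow hU hUV hcl
  intro h0
  have hcont : Tendsto (fun x : E => M * ‖x‖ ^ k) (𝓝 0) (𝓝 0) := by
    have : ContinuousAt (fun x : E => M * ‖x‖ ^ k) 0 :=
      continuousAt_const.mul (continuous_norm.continuousAt.rpow_const (Or.inr H.pos.le))
    simpa [ContinuousAt, Real.zero_rpow H.pos.ne'] using this
  obtain ⟨x, hx, hxc⟩ := mem_closure_iff_nhds.1 h0 _ (hcont.eventually (gt_mem_nhds hc))
  have hx0 : x ≠ 0 := fun h => H.zero_notMem_posCone hUV (h ▸ hxc.1)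
  have hx' : M * ‖x‖ ^ k < c := hx
  linarith [hM x hxc.1.1 hx0, hxc.2]

theorem isClosed_superlevel [FiniteDimensional ℝ E] (H : IsSmoothHomogeneous V h k)
    (hU : IsCone U) (hUV : U ⊆ V) (hcl : closure U \ {0} ⊆ V)
    (hP : ∀ x ∈ closure (posCone h U), x ∈ V → 0 < h x → x ∈ posCone h U) {c : ℝ} (hc : 0 < c) :
    IsClosed {x ∈ posCone h U | c ≤ h x} := by
  refine isClosed_of_closure_subset fun x hx => ?_
  have hx0 : x ≠ 0 := fun h => H.zero_notMem_closure hU hUV hcl hc (h ▸ hx)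
  have hxP : x ∈ closure (posCone h U) := closure_mono (fun y hy => hy.1) hx
  have hxV : x ∈ V := hcl ⟨closure_mono (fun y hy => hy.1) hxP, hx0⟩
  have hge : c ≤ h x := by
    by_contra hlt
    push Not at hlt
    obtain ⟨y, hy1, hy2⟩ := mem_closure_iff_nhds.1 hx _
      ((H.continuousAt hxV).eventually (gt_mem_nhds hlt))
    exact (not_lt.2 hy2.2) hy1
  exact ⟨hP x hxP hxV (hc.trans_le hge), hge⟩

theorem isClosed_unitLevelSet [FiniteDimensional ℝ E] (H : IsSmoothHomogeneous V h k)
    (hU : IsCone U) (hUV : U ⊆ V) (hcl : closure U \ {0} ⊆ V)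
    (hP : ∀ x ∈ closure U, x ∈ V → 0 < h x → x ∈ U) : IsClosed (unitLevelSet h U) := by
  have h1 := H.isClosed_superlevel hU hUV hcl (c := 1)
    (fun x hx hxV h0 => ⟨hP x (closure_mono (fun y hy => hy.1) hx) hxV h0, h0⟩) one_pos
  refine isClosed_of_closure_subset fun x hx => ?_
  have hsub : unitLevelSet h U ⊆ {x ∈ posCone h U | 1 ≤ h x} :=
    fun y hy => ⟨unitLevelSet_subset hy, hy.2.ge⟩
  have hxP := h1.closure_subset_iff.2 hsub hx
  refine ⟨hxP.1.1, le_antisymm ?_ hxP.2⟩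
  by_contra hlt
  push Not at hlt
  obtain ⟨y, hy1, hy2⟩ := mem_closure_iff_nhds.1 hx _
    ((H.continuousAt (hUV hxP.1.1)).eventually (lt_mem_nhds hlt))
  exact absurd hy2.2 (ne_of_gt hy1)

end IsSmoothHomogeneous

end Completeness
/-! ### Convexity -/

section Convexity

/-- The second derivative of u^(1/k) is u^(1/k - 2) / k² times k u u'' - (k - 1) u'². -/
theorem concaveOn_rpow_of_mul_le {k : ℝ} (hk : 1 < k) {u u' u'' : ℝ → ℝ}
    (hpos : ∀ s ∈ Icc (0 : ℝ) 1, 0 < u s) (hu : ∀ s ∈ Icc (0 : ℝ) 1, HasDerivAt u (u' s) s)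
    (hu' : ∀ s ∈ Icc (0 : ℝ) 1, HasDerivAt u' (u'' s) s)
    (hle : ∀ s ∈ Icc (0 : ℝ) 1, k * u s * u'' s ≤ (k - 1) * u' s ^ 2) :
    ConcaveOn ℝ (Icc 0 1) fun s => u s ^ (1 / k) := by
  have hk0 : 0 < k := one_pos.trans hk
  have hsub : interior (Icc (0 : ℝ) 1) ⊆ Icc 0 1 := interior_subset
  refine concaveOn_of_hasDerivWithinAt2_nonpos (convex_Icc 0 1)
    (f' := fun s => u' s * (1 / k) * u s ^ (1 / k - 1))
    (f'' := fun s => u'' s * (1 / k) * u s ^ (1 / k - 1) +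
      u' s * (1 / k) * (u' s * (1 / k - 1) * u s ^ (1 / k - 1 - 1))) ?_ ?_ ?_ ?_
  · exact fun s hs => ((hu s hs).rpow_const (Or.inl (hpos s hs).ne')).continuousAt
      |>.continuousWithinAt
  · exact fun s hs => ((hu s (hsub hs)).rpow_const
      (Or.inl (hpos s (hsub hs)).ne')).hasDerivWithinAt
  · exact fun s hs => (((hu' s (hsub hs)).mul_const _).mul ((hu s (hsub hs)).rpow_const
      (Or.inl (hpos s (hsub hs)).ne'))).hasDerivWithinAt
  · intro s hs
    have hp := hpos s (hsub hs)
    have h1 : u s ^ (1 / k - 1) = u s ^ (1 / k - 1 - 1) * u s := by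
      rw [← Real.rpow_add_one hp.ne']; ring_nf
    have h2 := hle s (hsub hs)
    have h3 : 0 < u s ^ (1 / k - 1 - 1) := Real.rpow_pos_of_pos hp _
    have h4 : u'' s * (1 / k) * u s ^ (1 / k - 1) +
        u' s * (1 / k) * (u' s * (1 / k - 1) * u s ^ (1 / k - 1 - 1)) =
        u s ^ (1 / k - 1 - 1) / k ^ 2 * (k * u s * u'' s - (k - 1) * u' s ^ 2) := by
      rw [h1]; field_simp; ring
    rw [h4]
    exact mul_nonpos_of_nonneg_of_nonpos (by positivity) (by linarith)

variable {E : Type*} [NormedAddCommGroup E] [NormedSpace ℝ E]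

theorem Convex.add_smul_mem_of_isCone {P : Set E} (hc : Convex ℝ P) (ho : IsOpen P)
    (hP : IsCone P) {p q : E} (hp : p ∈ P) (hq : q ∈ closure P) {t : ℝ} (ht : 0 ≤ t) :
    p + t • q ∈ P := by
  have h1 : 0 < 1 + t := by linarith
  -- Up to the factor 1 + t, the point p + t q is a convex combination of an interior point and a
  -- closure point.
  have h2 := hc.combo_interior_closure_mem_interior (ho.interior_eq.symm ▸ hp) hq
    (a := 1 / (1 + t)) (b := t / (1 + t)) (by positivity) (by positivity) (by field_simp)
  rw [ho.interior_eq] at h2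
  have h3 := hP (1 + t) h1 _ h2
  rwa [smul_add, smul_smul, smul_smul, mul_one_div_cancel h1.ne', mul_div_cancel₀ _ h1.ne',
    one_smul] at h3

namespace IsSmoothHomogeneous

variable {V U : Set E} {h : E → ℝ} {k : ℝ} {x y p q : E}

/-- In the splitting ker dh_x ⊕ ℝx the radial part gives equality, and the part in ker dh_x only
lowers the left side. This is the differential inequality behind the concavity of h^(1/k). -/
theorem mul_hess_le (H : IsSmoothHomogeneous V h k) (hx : x ∈ V) (h0 : 0 < h x)
    (hneg : ∀ v, v ≠ 0 → fderiv ℝ h x v = 0 → fderiv ℝ (fderiv ℝ h) x v v < 0) (v : E) :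
    k * h x * fderiv ℝ (fderiv ℝ h) x v v ≤ (k - 1) * fderiv ℝ h x v ^ 2 := by
  obtain ⟨h1, h2⟩ := H.hess_decomp hx h0.ne' v
  have hk := H.pos
  set w := v - (fderiv ℝ h x v / (k * h x)) • x
  have h3 : fderiv ℝ (fderiv ℝ h) x w w ≤ 0 := by
    by_cases hw : w = 0
    · simp [hw]
    · exact (hneg w hw h1).le
  have h4 : k * h x * fderiv ℝ (fderiv ℝ h) x v v =
      k * h x * fderiv ℝ (fderiv ℝ h) x w w + (k - 1) * fderiv ℝ h x v ^ 2 := by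
    rw [h2]; field_simp
  have h5 := mul_nonneg (mul_pos hk h0).le (neg_nonneg.2 h3)
  linarith

theorem concaveOn_lineMap (H : IsSmoothHomogeneous V h k) (hUV : U ⊆ V)
    (hneg : ∀ x ∈ posCone h U, ∀ v, v ≠ 0 → fderiv ℝ h x v = 0 →
      fderiv ℝ (fderiv ℝ h) x v v < 0) (hseg : segment ℝ x y ⊆ posCone h U) :
    ConcaveOn ℝ (Icc 0 1) fun s : ℝ => h (AffineMap.lineMap x y s) ^ (1 / k) := by
  have hmem : ∀ s ∈ Icc (0 : ℝ) 1, AffineMap.lineMap x y s ∈ posCone h U := fun s hs => by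
    apply hseg; rw [segment_eq_image_lineMap]; exact mem_image_of_mem _ hs
  refine concaveOn_rpow_of_mul_le H.one_lt
    (u' := fun s => fderiv ℝ h (AffineMap.lineMap x y s) (y - x))
    (u'' := fun s => fderiv ℝ (fderiv ℝ h) (AffineMap.lineMap x y s) (y - x) (y - x))
    (fun s hs => (hmem s hs).2) ?_ ?_ ?_
  · intro s hs
    exact (H.differentiableAt (hUV (hmem s hs).1)).hasFDerivAt.comp_hasDerivAt s
      AffineMap.hasDerivAt_lineMap
  · intro s hs
    have h1 := (H.differentiableAt_fderiv (hUV (hmem s hs).1)).hasFDerivAt.comp_hasDerivAt s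
      AffineMap.hasDerivAt_lineMap
    simpa using! h1.clm_apply (hasDerivAt_const s (y - x))
  · intro s hs
    exact H.mul_hess_le (hUV (hmem s hs).1) (hmem s hs).2 (hneg _ (hmem s hs)) _

/-- The concavity of `h ^ (1 / k)`, expressed by its tangent hyperplanes. -/
theorem le_fderiv (H : IsSmoothHomogeneous V h k) (hUV : U ⊆ V)
    (hneg : ∀ x ∈ posCone h U, ∀ v, v ≠ 0 → fderiv ℝ h x v = 0 →
      fderiv ℝ (fderiv ℝ h) x v v < 0) (hseg : segment ℝ x y ⊆ posCone h U) :
    k * h x ^ (1 - 1 / k) * h y ^ (1 / k) ≤ fderiv ℝ h x y := by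
  have hx := hseg (left_mem_segment ℝ x y)
  have hxV := hUV hx.1
  have hc := H.concaveOn_lineMap hUV hneg hseg
  have hd : HasDerivAt (fun s : ℝ => h (AffineMap.lineMap x y s) ^ (1 / k))
      (fderiv ℝ h x (y - x) * (1 / k) * h x ^ (1 / k - 1)) 0 := by
    have h1 : HasFDerivAt h (fderiv ℝ h x) (AffineMap.lineMap x y (0 : ℝ)) := by
      simpa using (H.differentiableAt hxV).hasFDerivAt
    have h2 := h1.comp_hasDerivAt (0 : ℝ) AffineMap.hasDerivAt_lineMap
    simpa using h2.rpow_const (p := 1 / k) (Or.inl (by simpa using hx.2.ne'))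
  have h1 := hc.slope_le_of_hasDerivAt (x := 0) (y := 1) (by simp) (by simp) one_pos hd
  rw [slope_def_field, AffineMap.lineMap_apply_one, AffineMap.lineMap_apply_zero, map_sub,
    H.euler x hxV, sub_zero, div_one] at h1
  have hk := H.pos
  have h2 : h x ^ (1 / k) = h x ^ (1 / k - 1) * h x := by
    rw [← Real.rpow_add_one hx.2.ne', sub_add_cancel]
  have h3 : h x ^ (1 - 1 / k) * h x ^ (1 / k - 1) = 1 := by
    rw [← Real.rpow_add hx.2]; simp
  have h4 : 0 < h x ^ (1 - 1 / k) := Real.rpow_pos_of_pos hx.2 _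
  have h5 : h y ^ (1 / k) ≤ fderiv ℝ h x y * (1 / k) * h x ^ (1 / k - 1) := by
    have : (fderiv ℝ h x y - k * h x) * (1 / k) * h x ^ (1 / k - 1) =
      fderiv ℝ h x y * (1 / k) * h x ^ (1 / k - 1) - h x ^ (1 / k) := by
        rw [h2]; field_simp
    linarith
  calc k * h x ^ (1 - 1 / k) * h y ^ (1 / k)
      ≤ k * h x ^ (1 - 1 / k) * (fderiv ℝ h x y * (1 / k) * h x ^ (1 / k - 1)) := by gcongr
    _ = (k * (1 / k)) * (h x ^ (1 - 1 / k) * h x ^ (1 / k - 1)) * fderiv ℝ h x y := by ring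
    _ = fderiv ℝ h x y := by rw [h3, mul_one_div_cancel hk.ne']; ring

/-- For fixed x, consider the points y whose segment from x stays in the cone. They form an open set
by compactness of the segment. They form a relatively closed set because concavity keeps h bounded
below along such segments, so that limits of segments stay in a closed superlevel set. Connectedness
concludes. -/
theorem convex_posCone [FiniteDimensional ℝ E] (H : IsSmoothHomogeneous V h k) (hUo : IsOpen U)
    (hU : IsCone U) (hUV : U ⊆ V) (hcl : closure U \ {0} ⊆ V)
    (hP : ∀ x ∈ closure (posCone h U), x ∈ V → 0 < h x → x ∈ posCone h U)
    (hconn : IsPreconnected (posCone h U))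
    (hneg : ∀ x ∈ posCone h U, ∀ v, v ≠ 0 → fderiv ℝ h x v = 0 →
      fderiv ℝ (fderiv ℝ h) x v v < 0) : Convex ℝ (posCone h U) := by
  have hPo := H.isOpen_posCone hUo hUV
  rw [convex_iff_segment_subset]
  intro x hx
  suffices hsuff : posCone h U ⊆ {y | segment ℝ x y ⊆ posCone h U} from fun y hy => hsuff hy
  have hline : Continuous fun z : E × ℝ => (AffineMap.lineMap x z.1 z.2 : E) := by
    simp only [AffineMap.lineMap_apply, vsub_eq_sub, vadd_eq_add]; fun_prop
  refine hconn.subset_of_closure_inter_subset ?_ ⟨x, hx, by simpa using hx⟩ ?_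
  · rw [isOpen_iff_mem_nhds]
    intro y hy
    have := isCompact_Icc.eventually_forall_of_forall_eventually (x₀ := y) (K := Icc (0 : ℝ) 1)
      (P := fun z s => (AffineMap.lineMap x z s : E) ∈ posCone h U) (fun s hs => by
        refine hline.continuousAt.eventually (hPo.mem_nhds (hy ?_))
        rw [segment_eq_image_lineMap]; exact mem_image_of_mem _ hs)
    filter_upwards [this] with z hz
    rw [segment_eq_image_lineMap]
    rintro _ ⟨s, hs, rfl⟩
    exact hz s hs
  · rintro y ⟨hy, hyP⟩
    rw [mem_ofPred_eq, segment_eq_image_lineMap]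
    rintro _ ⟨s, hs, rfl⟩
    -- Half of h y leaves room for a lower bound valid at all endpoints z near y.
    set c := min (h x) (h y / 2) with hc
    have hc0 : 0 < c := lt_min hx.2 (half_pos hyP.2)
    have hclosed := H.isClosed_superlevel hU hUV hcl hP hc0
    have hnear : ∀ᶠ z in 𝓝 y, h y / 2 < h z :=
      (H.continuousAt (hUV hyP.1)).eventually (lt_mem_nhds (half_lt_self hyP.2))
    have hy' : y ∈ closure ({z | segment ℝ x z ⊆ posCone h U} ∩ {z | h y / 2 < h z}) :=
      mem_closure_iff_nhds.2 fun t ht => by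
        obtain ⟨z, hz1, hz2⟩ := mem_closure_iff_nhds.1 hy _ (inter_mem ht hnear)
        exact ⟨z, hz1.1, hz2, hz1.2⟩
    have hcont : Continuous fun z : E => (AffineMap.lineMap x z s : E) :=
      hline.comp (continuous_id.prodMk continuous_const)
    refine (hclosed.closure_subset_iff.2 ?_ (map_mem_closure hcont hy'
      (mapsTo_image _ _))).1
    rintro _ ⟨z, ⟨hz1, hz2⟩, rfl⟩
    have hz1 : segment ℝ x z ⊆ posCone h U := hz1
    have hzP := hz1 (right_mem_segment ℝ x z)
    have hzs : (AffineMap.lineMap x z s : E) ∈ posCone h U := by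
      apply hz1; rw [segment_eq_image_lineMap]; exact mem_image_of_mem _ hs
    refine ⟨hzs, ?_⟩
    have h1 := (H.concaveOn_lineMap hUV hneg hz1).2 (x := 0) (y := 1) (by simp) (by simp)
      (sub_nonneg.2 hs.2) hs.1 (by ring)
    simp only [smul_eq_mul, mul_zero, mul_one, zero_add, AffineMap.lineMap_apply_zero,
      AffineMap.lineMap_apply_one] at h1
    have hk : 0 < 1 / k := one_div_pos.2 H.pos
    have h2 : c ^ (1 / k) ≤ h x ^ (1 / k) :=
      Real.rpow_le_rpow hc0.le (min_le_left _ _) hk.le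
    have h3 : c ^ (1 / k) ≤ h z ^ (1 / k) :=
      Real.rpow_le_rpow hc0.le ((min_le_right _ _).trans (le_of_lt hz2)) hk.le
    refine (Real.rpow_le_rpow_iff hc0.le hzs.2.le hk).1 ?_
    nlinarith [hs.1, hs.2, mul_nonneg (sub_nonneg.2 hs.2) (sub_nonneg.2 h2),
      mul_nonneg hs.1 (sub_nonneg.2 h3)]

/-- Nonnegativity at every point of the cone follows from the tangent inequality `le_fderiv` by
passing to the closure. If dh_p(q) = 0, then D²h_p(q, q) < 0 makes dh(q) negative at p + t q for
small t > 0, although these points are still in the convex cone. -/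
theorem fderiv_pos_of_mem_closure (H : IsSmoothHomogeneous V h k) (hUo : IsOpen U)
    (hU : IsCone U) (hUV : U ⊆ V) (hconv : Convex ℝ (posCone h U))
    (hneg : ∀ x ∈ posCone h U, ∀ v, v ≠ 0 → fderiv ℝ h x v = 0 →
      fderiv ℝ (fderiv ℝ h) x v v < 0) (hp : p ∈ posCone h U) (hq : q ∈ closure (posCone h U))
    (hq0 : q ≠ 0) : 0 < fderiv ℝ h p q := by
  have hPo := H.isOpen_posCone hUo hUV
  have hPc := H.isCone_posCone hU hUV
  have hnn : ∀ x ∈ posCone h U, 0 ≤ fderiv ℝ h x q := by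
    intro x hx
    have hcl : IsClosed {z | 0 ≤ fderiv ℝ h x z} :=
      isClosed_le continuous_const (fderiv ℝ h x).continuous
    refine hcl.closure_subset_iff.2 (fun y hy => ?_) hq
    refine le_trans ?_ (H.le_fderiv hUV hneg (hconv.segment_subset hx hy))
    exact mul_nonneg (mul_nonneg H.pos.le (Real.rpow_nonneg hx.2.le _))
      (Real.rpow_nonneg hy.2.le _)
  refine (hnn p hp).lt_of_ne fun h0 => ?_
  have hlt := hneg p hp q hq0 h0.symm
  have hd : HasDerivAt (fun t : ℝ => fderiv ℝ h (p + t • q) q)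
      (fderiv ℝ (fderiv ℝ h) p q q) 0 := by
    have h1 : HasDerivAt (fun t : ℝ => p + t • q) q 0 := by
      simpa using ((hasDerivAt_id (0 : ℝ)).smul_const q).const_add p
    have h2 : HasFDerivAt (fderiv ℝ h) (fderiv ℝ (fderiv ℝ h) p) (p + (0 : ℝ) • q) := by
      simpa using (H.differentiableAt_fderiv (hUV hp.1)).hasFDerivAt
    have h3 : HasDerivAt (fun t : ℝ => fderiv ℝ h (p + t • q))
        (fderiv ℝ (fderiv ℝ h) p q) 0 :=
      HasFDerivAt.comp_hasDerivAt (f := fun t : ℝ => p + t • q) 0 h2 h1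
    exact (h3.clm_apply (hasDerivAt_const (0 : ℝ) q)).congr_deriv (by simp)
  have := ge_of_tendsto hd.tendsto_slope_zero_right (b := 0) (by
    filter_upwards [self_mem_nhdsWithin] with t ht
    have ht : 0 < t := ht
    have h1 := hnn _ (hconv.add_smul_mem_of_isCone hPo hPc hp hq ht.le)
    simp only [zero_add, zero_smul, add_zero, ← h0, sub_zero, smul_eq_mul]
    positivity)
  linarith

end IsSmoothHomogeneous

end Convexity
/-! ### Admissible cones -/

section Admissible

variable {E : Type*} [NormedAddCommGroup E] [NormedSpace ℝ E]

theorem IsCone.closure {P : Set E} (hP : IsCone P) : IsCone (closure P) :=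
  fun t ht _ hx => map_mem_closure (continuous_const_smul t) hx fun y hy => hP t ht y hy

theorem IsCone.frontier {P : Set E} (hP : IsCone P) (ho : IsOpen P) : IsCone (frontier P) := by
  intro t ht x hx
  rw [ho.frontier_eq] at hx ⊢
  refine ⟨hP.closure t ht x hx.1, fun h => hx.2 ?_⟩
  simpa [smul_smul, inv_mul_cancel₀ ht.ne'] using hP _ (inv_pos.2 ht) _ h

theorem IsCone.mem_tangentSpaceAt {S : Set E} (hS : IsCone S) {p : E} (hp : p ∈ S) :
    p ∈ tangentSpaceAt S p := by
  refine Submodule.subset_span ⟨fun t => (1 + t) • p, ⟨by simp, 1, one_pos, ?_, ?_⟩, ?_⟩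
  · exact ContDiff.contDiffOn (by fun_prop)
  · exact fun t ht => hS _ (by linarith [ht.1]) p hp
  · have : HasDerivAt (fun t : ℝ => (1 + t) • p) ((1 : ℝ) • p) 0 :=
      ((hasDerivAt_id (0 : ℝ)).const_add 1).smul_const p
    simpa using this.deriv

namespace IsSmoothHomogeneous

variable {V U : Set E} {h : E → ℝ} {k : ℝ} {x y p q : E}

theorem isConnected_posCone (H : IsSmoothHomogeneous V h k) (hU : IsCone U) (hUV : U ⊆ V)
    (hS : IsConnected (unitLevelSet h U)) : IsConnected (posCone h U) := by
  have h1 : posCone h U = (fun z : ℝ × E => z.1 • z.2) '' (Ioi 0 ×ˢ unitLevelSet h U) := by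
    rw [← H.coneOver_unitLevelSet hU hUV]
    ext y
    constructor
    · rintro ⟨t, ht, x, hx, rfl⟩
      exact ⟨(t, x), ⟨ht, hx⟩, rfl⟩
    · rintro ⟨⟨t, x⟩, ⟨ht, hx⟩, rfl⟩
      exact ⟨t, ht, x, hx, rfl⟩
  rw [h1]
  exact (isConnected_Ioi.prod hS).image _ (by fun_prop)

theorem isConnected_unitLevelSet (H : IsSmoothHomogeneous V h k) (hU : IsCone U) (hUV : U ⊆ V)
    (hP : IsConnected (posCone h U)) : IsConnected (unitLevelSet h U) := by
  have h1 : unitLevelSet h U = radialProj h k '' posCone h U := by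
    ext y
    constructor
    · exact fun hy => ⟨y, unitLevelSet_subset hy, by simp [radialProj, hy.2]⟩
    · rintro ⟨x, hx, rfl⟩
      exact H.radialProj_mem hU hUV hx
  rw [h1]
  exact hP.image _ fun x hx =>
    (H.contDiffAt_radialProj (hUV hx.1) hx.2).continuousAt.continuousWithinAt

theorem isAdmissibleCone [FiniteDimensional ℝ E] (H : IsSmoothHomogeneous V h k)
    (hUo : IsOpen U) (hU : IsCone U) (hUV : U ⊆ V) (hcl : closure U \ {0} ⊆ V)
    (hconn : IsConnected (posCone h U))
    (hclosed : ∀ x ∈ closure U, x ∈ V → 0 < h x → x ∈ U)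
    (hneg : ∀ x ∈ posCone h U, ∀ v, v ≠ 0 → fderiv ℝ h x v = 0 →
      fderiv ℝ (fderiv ℝ h) x v v < 0) : IsAdmissibleCone V h U where
  isOpen := hUo
  isCone := hU
  subset := hUV
  closure_subset := hcl
  connected := H.isConnected_unitLevelSet hU hUV hconn
  hyperbolic := H.isHyperbolicCentroaffine hUo hU hUV hneg
  complete := H.isEuclideanComplete_of_isClosed hUo hU hUV
    (H.isClosed_unitLevelSet hU hUV hcl hclosed)

theorem eq_zero_of_mem_frontier (H : IsSmoothHomogeneous V h k) (hUo : IsOpen U) (hUV : U ⊆ V)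
    (hcl : closure U \ {0} ⊆ V)
    (hP : ∀ x ∈ closure (posCone h U), x ∈ V → 0 < h x → x ∈ posCone h U)
    (hp : p ∈ frontier (posCone h U) \ {0}) :
    p ∈ closure (posCone h U) ∧ p ∈ V ∧ h p = 0 := by
  have hpc : p ∈ closure (posCone h U) := hp.1.1
  have hpV : p ∈ V := hcl ⟨closure_mono (fun y hy => hy.1) hpc, hp.2⟩
  have hpP : p ∉ posCone h U := by
    have := hp.1
    rw [(H.isOpen_posCone hUo hUV).frontier_eq] at this
    exact this.2
  refine ⟨hpc, hpV, le_antisymm (not_lt.1 fun h0 => hpP (hP p hpc hpV h0)) ?_⟩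
  by_contra hlt
  push Not at hlt
  obtain ⟨y, hy1, hy2⟩ := mem_closure_iff_nhds.1 hpc _
    ((H.continuousAt hpV).eventually (gt_mem_nhds hlt))
  exact lt_asymm hy2.2 hy1

/-- At a boundary point p the ray through p is tangent, and D²h_p(p, ·) = (k - 1) dh_p vanishes on
tangent vectors, so p spans a line in the kernel. The hypothesis excludes anything more. Only the
inclusion of the tangent space in ker dh_p is needed in this direction. -/
theorem hasRegularBoundary (H : IsSmoothHomogeneous V h k)
    (hUo : IsOpen U) (hU : IsCone U) (hUV : U ⊆ V) (hcl : closure U \ {0} ⊆ V)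
    (hP : ∀ x ∈ closure (posCone h U), x ∈ V → 0 < h x → x ∈ posCone h U)
    (hreg : ∀ x ∈ closure (posCone h U), x ∈ V → x ≠ 0 → h x = 0 → fderiv ℝ h x ≠ 0 ∧
      ∀ v, fderiv ℝ h x v = 0 → fderiv ℝ (fderiv ℝ h) x v v ≤ 0 ∧
        (fderiv ℝ (fderiv ℝ h) x v v = 0 → ∃ c : ℝ, c • x = v)) :
    HasRegularBoundary h (unitLevelSet h U) := by
  intro p hp
  rw [H.coneOver_unitLevelSet hU hUV] at hp ⊢
  obtain ⟨hpc, hpV, hp0⟩ := H.eq_zero_of_mem_frontier hUo hUV hcl hP hp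
  obtain ⟨hd, hh⟩ := hreg p hpc hpV hp.2 hp0
  set S := frontier (posCone h U) \ {0} with hS
  have hSc : IsCone S := fun t ht x hx =>
    ⟨(H.isCone_posCone hU hUV).frontier (H.isOpen_posCone hUo hUV) t ht x hx.1,
      smul_ne_zero ht.ne' hx.2⟩
  have hker : ∀ v ∈ tangentSpaceAt S p, fderiv ℝ h p v = 0 := fun v hv =>
    H.tangentSpaceAt_le_ker (c := 0)
      (fun y hy => (H.eq_zero_of_mem_frontier hUo hUV hcl hP hy).2.2) hpV hv
  have hpT : p ∈ tangentSpaceAt S p := hSc.mem_tangentSpaceAt hp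
  refine ⟨hd, fun v hv => neg_nonneg.2 (hh v (hker v hv)).1, ?_⟩
  have hmem : (⟨p, hpT⟩ : tangentSpaceAt S p) ∈
      LinearMap.ker ((-hessianForm h p).restrict (tangentSpaceAt S p)) := by
    rw [LinearMap.mem_ker]
    ext w
    simp [hessianForm, H.hess_self_left hpV, hker w w.2]
  refine (finrank_eq_one_iff_of_nonzero' ⟨⟨p, hpT⟩, hmem⟩
    (fun h0 => hp.2 (by simpa using congrArg (fun a => (a.1.1 : E)) h0))).2 ?_
  rintro ⟨⟨w, hwT⟩, hw⟩
  have hww : fderiv ℝ (fderiv ℝ h) p w w = 0 := by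
    have := congrArg (fun L => L ⟨w, hwT⟩) (LinearMap.mem_ker.1 hw)
    simpa [hessianForm] using this
  obtain ⟨c, hc⟩ := (hh w (hker w hwT)).2 hww
  exact ⟨c, Subtype.ext (Subtype.ext hc)⟩

end IsSmoothHomogeneous

namespace IsAdmissibleCone

variable {V U : Set E} {h : E → ℝ} {k : ℝ}

theorem hess_neg (A : IsAdmissibleCone V h U) (H : IsSmoothHomogeneous V h k) :
    ∀ x ∈ posCone h U, ∀ v, v ≠ 0 → fderiv ℝ h x v = 0 → fderiv ℝ (fderiv ℝ h) x v v < 0 :=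
  H.hess_neg_of_isHyperbolicCentroaffine A.isOpen A.isCone A.subset A.hyperbolic

theorem mem_posCone [FiniteDimensional ℝ E] (A : IsAdmissibleCone V h U)
    (H : IsSmoothHomogeneous V h k) :
    ∀ x ∈ closure (posCone h U), x ∈ V → 0 < h x → x ∈ posCone h U := fun _ hx hV h0 =>
  have := FiniteDimensional.complete ℝ E
  H.mem_posCone_of_isEuclideanComplete A.isOpen A.isCone A.subset A.complete hV h0 hx

theorem convex [FiniteDimensional ℝ E] (A : IsAdmissibleCone V h U)
    (H : IsSmoothHomogeneous V h k) : Convex ℝ (posCone h U) :=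
  H.convex_posCone A.isOpen A.isCone A.subset A.closure_subset (A.mem_posCone H)
    (H.isConnected_posCone A.isCone A.subset A.connected).isPreconnected (A.hess_neg H)

theorem fderiv_pos [FiniteDimensional ℝ E] (A : IsAdmissibleCone V h U)
    (H : IsSmoothHomogeneous V h k) {p q : E} (hp : p ∈ posCone h U)
    (hq : q ∈ closure (posCone h U)) (hq0 : q ≠ 0) : 0 < fderiv ℝ h p q :=
  H.fderiv_pos_of_mem_closure A.isOpen A.isCone A.subset (A.convex H) (A.hess_neg H) hp hq hq0

end IsAdmissibleCone

end Admissible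
/-! ### A homogeneous perturbation -/

section Perturbation

/-- Differentiating lowers the exponent by one, until it is 0 or negative; a nonzero multiple of a
negative power is unbounded at 0. It serves to show that k is an integer if 0 lies in V. -/
theorem exists_nat_eq_of_contDiffAt_rpow (m : ℕ) : ∀ (a c : ℝ) (g : ℝ → ℝ), a < m → c ≠ 0 →
    ContDiffAt ℝ ∞ g 0 → (∀ᶠ t in 𝓝[>] (0 : ℝ), g t = c * t ^ a) → ∃ n : ℕ, a = n := by
  induction m with
  | zero =>
    intro a c g ha hc hg he
    exfalso
    have ha' : 0 < -a := by simpa using ha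
    have h1 : Tendsto g (𝓝[>] 0) (𝓝 (g 0)) := hg.continuousAt.tendsto.mono_left nhdsWithin_le_nhds
    have h2 : Tendsto (fun t : ℝ => t ^ (-a)) (𝓝[>] 0) (𝓝 0) := by
      have : ContinuousAt (fun t : ℝ => t ^ (-a)) 0 :=
        Real.continuousAt_rpow_const _ _ (Or.inr ha'.le)
      rw [ContinuousAt, Real.zero_rpow ha'.ne'] at this
      exact this.mono_left nhdsWithin_le_nhds
    have h3 : Tendsto (fun _ : ℝ => c) (𝓝[>] 0) (𝓝 (g 0 * 0)) := by
      refine (h1.mul h2).congr' ?_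
      filter_upwards [he, self_mem_nhdsWithin] with t ht ht0
      have ht0 : 0 < t := ht0
      rw [ht, mul_assoc, ← Real.rpow_add ht0]; simp
    rw [mul_zero] at h3
    exact hc (tendsto_nhds_unique tendsto_const_nhds h3)
  | succ m ih =>
    intro a c g ha hc hg he
    by_cases ha0 : a = 0
    · exact ⟨0, by simpa using ha0⟩
    have hg' : ContDiffAt ℝ ∞ (deriv g) 0 := by
      have h5 : ContDiffAt ℝ ∞ (fun t => fderiv ℝ g t 1) 0 :=
        (hg.fderiv_right (m := ∞) (by simp)).clm_apply contDiffAt_const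
      exact h5
    obtain ⟨n, hn⟩ := ih (a - 1) (c * a) (deriv g) (by push_cast at ha; linarith)
      (mul_ne_zero hc ha0) hg' (by
        obtain ⟨r, hr, hb⟩ := mem_nhdsGT_iff_exists_Ioo_subset.1 he
        filter_upwards [Ioo_mem_nhdsGT hr] with t ht
        have h1 : g =ᶠ[𝓝 t] fun s => c * s ^ a := by
          filter_upwards [isOpen_Ioo.mem_nhds ht] with s hs using hb hs
        rw [h1.deriv_eq, ((Real.hasDerivAt_rpow_const (Or.inl ht.1.ne')).const_mul c).deriv]
        ring)
    exact ⟨n + 1, by push_cast; linarith⟩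

theorem fderiv_self_of_homog {E : Type*} [NormedAddCommGroup E] [NormedSpace ℝ E] {q : E → ℝ}
    {k : ℝ} {x : E} (hd : DifferentiableAt ℝ q x)
    (hq : ∀ t : ℝ, 0 < t → q (t • x) = t ^ k * q x) : fderiv ℝ q x x = k * q x := by
  have h1 : HasDerivAt (fun t : ℝ => t • x) x 1 := by
    simpa using (hasDerivAt_id (1 : ℝ)).smul_const x
  have h2 : HasFDerivAt q (fderiv ℝ q x) ((1 : ℝ) • x) := by simpa using hd.hasFDerivAt
  have h3 : HasDerivAt (fun t : ℝ => q (t • x)) (fderiv ℝ q x x) 1 :=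
    HasFDerivAt.comp_hasDerivAt (f := fun t : ℝ => t • x) 1 h2 h1
  have h4 : HasDerivAt (fun t : ℝ => t ^ k * q x) (k * q x) 1 := by
    simpa using (Real.hasDerivAt_rpow_const (x := 1) (p := k) (Or.inl one_ne_zero)).mul_const (q x)
  refine h3.unique (h4.congr_of_eventuallyEq ?_)
  filter_upwards [lt_mem_nhds (one_pos : (0 : ℝ) < 1)] with t ht using hq t ht

variable {E : Type*} [NormedAddCommGroup E] [InnerProductSpace ℝ E]

/-- A smooth homogeneous function on the punctured space which is equal to a power of a given
linear functional in a given circular cone around its gradient. -/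
theorem exists_homogeneous_cutoff (l : E →L[ℝ] ℝ) {δ : ℝ} (hδ : 0 < δ) (k : ℝ) :
    ∃ q : E → ℝ, ContDiffOn ℝ ∞ q {0}ᶜ ∧ IsHomogeneousOn q {0}ᶜ k ∧
      ∀ x, x ≠ 0 → δ * ‖x‖ ≤ l x → q x = l x ^ k := by
  -- The cutoff depends on the degree-zero ratio l(x) / (δ‖x‖): it is 0 up to ratio 1/2 and 1 from
  -- ratio 1 on. Thus q vanishes near the points with l ≤ 0, where the real power need not be
  -- smooth.
  set q : E → ℝ := fun x => Real.smoothTransition (2 * (l x / (δ * ‖x‖)) - 1) * l x ^ k with hq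
  have hzero : ∀ x : E, x ≠ 0 → 2 * l x ≤ δ * ‖x‖ → q x = 0 := by
    intro x hx hle
    have hn : 0 < δ * ‖x‖ := mul_pos hδ (norm_pos_iff.2 hx)
    rw [hq]
    simp only
    rw [Real.smoothTransition.zero_of_nonpos, zero_mul]
    rw [sub_nonpos, mul_div_assoc', div_le_one hn]
    exact hle
  have hsmooth : ∀ x : E, x ≠ 0 → ContDiffAt ℝ ∞ q x := by
    intro x hx
    have hn : 0 < δ * ‖x‖ := mul_pos hδ (norm_pos_iff.2 hx)
    rcases le_or_gt (l x) 0 with h0 | h0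
    · have h1 : ∀ᶠ y in 𝓝 x, 2 * l y < δ * ‖y‖ := by
        have : ContinuousAt (fun y => δ * ‖y‖ - 2 * l y) x := by fun_prop
        filter_upwards [this.eventually (lt_mem_nhds (by linarith : 0 < δ * ‖x‖ - 2 * l x))]
          with y hy
        linarith
      refine (contDiffAt_const (c := (0 : ℝ))).congr_of_eventuallyEq ?_
      filter_upwards [h1, isOpen_compl_singleton.mem_nhds hx] with y hy hy0
      exact hzero y hy0 hy.le
    · have h1 : ContDiffAt ℝ ∞ (fun y => 2 * (l y / (δ * ‖y‖)) - 1) x :=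
        (contDiffAt_const.mul (l.contDiff.contDiffAt.div
          (contDiffAt_const.mul (contDiffAt_norm ℝ hx)) hn.ne')).sub contDiffAt_const
      exact (Real.smoothTransition.contDiffAt.comp x h1).mul
        (l.contDiff.contDiffAt.rpow_const_of_ne h0.ne')
  refine ⟨q, fun x hx => (hsmooth x hx).contDiffWithinAt, fun x hx => ?_, fun x hx hle => ?_⟩
  · have hx : x ≠ 0 := hx
    refine fderiv_self_of_homog ((hsmooth x hx).differentiableAt (by simp)) fun t ht => ?_
    rcases le_or_gt (l x) 0 with h0 | h0
    · have hn : 0 < δ * ‖x‖ := mul_pos hδ (norm_pos_iff.2 hx)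
      rw [hzero x hx (by linarith), hzero (t • x) (smul_ne_zero ht.ne' hx), mul_zero]
      rw [map_smul, smul_eq_mul, norm_smul, Real.norm_of_nonneg ht.le]
      nlinarith
    · simp only [hq, map_smul, smul_eq_mul, norm_smul, Real.norm_of_nonneg ht.le]
      rw [Real.mul_rpow ht.le h0.le, show t * l x / (δ * (t * ‖x‖)) = l x / (δ * ‖x‖) by
        rw [mul_left_comm δ t, mul_div_mul_left _ _ ht.ne']]
      ring
  · have hn : 0 < δ * ‖x‖ := mul_pos hδ (norm_pos_iff.2 hx)
    simp only [hq]
    rw [Real.smoothTransition.one_of_one_le, one_mul]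
    have : 1 ≤ l x / (δ * ‖x‖) := (one_le_div hn).2 hle
    linarith

variable {V U : Set E} {h : E → ℝ} {k : ℝ}

theorem IsAdmissibleCone.exists_le_fderiv [FiniteDimensional ℝ E] (A : IsAdmissibleCone V h U)
    (H : IsSmoothHomogeneous V h k) {p : E} (hp : p ∈ posCone h U) :
    ∃ δ > 0, ∀ x ∈ closure (posCone h U), δ * ‖x‖ ≤ fderiv ℝ h p x := by
  have hK : IsCompact (closure (posCone h U) ∩ Metric.sphere 0 1) :=
    (isCompact_sphere 0 1).inter_left isClosed_closure
  obtain ⟨δ, hδ, hle⟩ := hK.exists_forall_le' (fderiv ℝ h p).continuous.continuousOn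
    (a := 0) fun x hx =>
      A.fderiv_pos H hp hx.1 (Metric.ne_of_mem_sphere hx.2 one_ne_zero)
  refine ⟨δ, hδ, fun x hx => ?_⟩
  rcases eq_or_ne x 0 with rfl | hx0
  · simp
  have hn : 0 < ‖x‖ := norm_pos_iff.2 hx0
  have h1 := hle (‖x‖⁻¹ • x)
    ⟨(H.isCone_posCone A.isCone A.subset).closure _ (inv_pos.2 hn) x hx, by
      simp [norm_smul, hn.ne']⟩
  rwa [map_smul, smul_eq_mul, le_inv_mul_iff₀ hn, mul_comm] at h1

/-- The power of the linear functional `l` extends from the cone to a smooth homogeneous function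
on `V`. -/
theorem IsAdmissibleCone.exists_extension [FiniteDimensional ℝ E] (A : IsAdmissibleCone V h U)
    (H : IsSmoothHomogeneous V h k) (l : E →L[ℝ] ℝ) {δ : ℝ} (hδ : 0 < δ)
    (hl : ∀ x ∈ closure (posCone h U), δ * ‖x‖ ≤ l x) :
    ∃ q : E → ℝ, IsSmoothHomogeneous V q k ∧ (∀ x ∉ V, q x = 0) ∧
      ∀ x ∈ closure (posCone h U), x ≠ 0 → q x = l x ^ k := by
  suffices hs : ∃ q : E → ℝ, ContDiffOn ℝ ∞ q V ∧ IsHomogeneousOn q V k ∧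
      ∀ x ∈ closure (posCone h U), x ≠ 0 → q x = l x ^ k by
    obtain ⟨q, h1, h2, h3⟩ := hs
    refine ⟨V.indicator q, ⟨H.isOpen, h1.congr fun x hx => indicator_of_mem hx q, ?_, H.one_lt⟩,
      fun x hx => indicator_of_notMem hx q, fun x hx hx0 => ?_⟩
    · intro x hx
      have : V.indicator q =ᶠ[𝓝 x] q := by
        filter_upwards [H.isOpen.mem_nhds hx] with y hy using indicator_of_mem hy q
      rw [this.fderiv_eq, this.eq_of_nhds, h2 x hx]
    · rw [indicator_of_mem (A.closure_subset ⟨closure_mono (fun y hy => hy.1) hx, hx0⟩),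
        h3 x hx hx0]
  -- If 0 is in V, smoothness of t ↦ h(t p) = t^k at 0 forces k to be a natural number, and l^k is a
  -- polynomial. Otherwise the cutoff, possibly singular at 0, is smooth on V.
  by_cases h0 : (0 : E) ∈ V
  · obtain ⟨p, hp⟩ := A.connected.nonempty
    have hline : ContDiffAt ℝ ∞ (fun t : ℝ => t • p) 0 := by fun_prop
    obtain ⟨n, hn⟩ := exists_nat_eq_of_contDiffAt_rpow (⌊k⌋₊ + 1) k 1 (fun t : ℝ => h (t • p))
      (by exact_mod_cast Nat.lt_floor_add_one k) one_ne_zero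
      (ContDiffAt.comp (0 : ℝ) (by simpa using H.contDiffAt h0) hline) (by
        filter_upwards [self_mem_nhdsWithin] with t ht
        rw [H.homog_of_mem_cone A.isCone A.subset hp.1 ht, hp.2, mul_one, one_mul])
    refine ⟨fun x => l x ^ k, ?_, ?_, fun _ _ _ => rfl⟩
    · simp only [hn, Real.rpow_natCast]
      exact (l.contDiff.pow n).contDiffOn
    · intro x _
      simp only [hn, Real.rpow_natCast]
      refine fderiv_self_of_homog (l.contDiff.pow n).contDiffAt.differentiableAt_one fun t _ => ?_
      rw [map_smul, smul_eq_mul, mul_pow, Real.rpow_natCast]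
  · obtain ⟨q, h1, h2, h3⟩ := exists_homogeneous_cutoff l hδ k
    have hV : V ⊆ {0}ᶜ := fun x hx h => h0 (h ▸ hx)
    exact ⟨q, h1.mono hV, fun x hx => h2 x (hV hx), fun x hx hx0 => h3 x hx0 (hl x hx)⟩

end Perturbation
/-! ### Density -/

section Density

variable {E : Type*} [NormedAddCommGroup E] [InnerProductSpace ℝ E]

namespace IsSmoothHomogeneous

variable {V U : Set E} {h q : E → ℝ} {k ε : ℝ} {x : E}

theorem hasFDerivAt_sub (H : IsSmoothHomogeneous V h k) (Hq : IsSmoothHomogeneous V q k)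
    (hx : x ∈ V) : HasFDerivAt (fun y => h y - ε * q y) (fderiv ℝ h x - ε • fderiv ℝ q x) x :=
  (H.differentiableAt hx).hasFDerivAt.sub ((Hq.differentiableAt hx).hasFDerivAt.const_mul ε)

theorem sub_const_mul (H : IsSmoothHomogeneous V h k) (Hq : IsSmoothHomogeneous V q k) (ε : ℝ) :
    IsSmoothHomogeneous V (fun y => h y - ε * q y) k where
  isOpen := H.isOpen
  smooth := H.smooth.sub (contDiffOn_const.mul Hq.smooth)
  euler x hx := by
    rw [(H.hasFDerivAt_sub Hq hx).fderiv, sub_apply, smul_apply, H.euler x hx, Hq.euler x hx,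
      smul_eq_mul]
    ring
  one_lt := H.one_lt

theorem hess_sub (H : IsSmoothHomogeneous V h k) (Hq : IsSmoothHomogeneous V q k) (hx : x ∈ V) :
    fderiv ℝ (fderiv ℝ fun y => h y - ε * q y) x =
      fderiv ℝ (fderiv ℝ h) x - ε • fderiv ℝ (fderiv ℝ q) x := by
  have h1 : fderiv ℝ (fun y => h y - ε * q y) =ᶠ[𝓝 x]
      fun y => fderiv ℝ h y - ε • fderiv ℝ q y := by
    filter_upwards [H.isOpen.mem_nhds hx] with y hy using (H.hasFDerivAt_sub Hq hy).fderiv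
  rw [h1.fderiv_eq]
  exact ((H.differentiableAt_fderiv hx).hasFDerivAt.sub
    ((Hq.differentiableAt_fderiv hx).hasFDerivAt.const_smul ε)).fderiv

theorem hasFDerivAt_rpow_clm (l : E →L[ℝ] ℝ) (h0 : 0 < l x) (k : ℝ) :
    HasFDerivAt (fun y => l y ^ k) ((k * l x ^ (k - 1)) • l) x :=
  l.hasFDerivAt.rpow_const (Or.inl h0.ne')

theorem hess_rpow_clm (l : E →L[ℝ] ℝ) (h0 : 0 < l x) (k : ℝ) (v : E) :
    fderiv ℝ (fderiv ℝ fun y => l y ^ k) x v v = k * (k - 1) * l x ^ (k - 2) * l v ^ 2 := by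
  have h1 : fderiv ℝ (fun y => l y ^ k) =ᶠ[𝓝 x] fun y => (k * l y ^ (k - 1)) • l := by
    filter_upwards [l.continuous.continuousAt.eventually (lt_mem_nhds h0)] with y hy
      using (hasFDerivAt_rpow_clm l hy k).fderiv
  rw [h1.fderiv_eq, (((hasFDerivAt_rpow_clm l h0 (k - 1)).const_mul k).smul_const l).fderiv]
  simp only [ContinuousLinearMap.smulRight_apply, smul_apply, smul_eq_mul]
  rw [show k - 1 - 1 = k - 2 by ring]
  ring

end IsSmoothHomogeneous

namespace IsAdmissibleCone

variable {V U : Set E} {h q : E → ℝ} {k ε : ℝ} {l : E →L[ℝ] ℝ} {p x : E}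

/-- Subtracting a power of a linear functional keeps the Hessian negative on the kernel of the
differential, also where the difference vanishes. -/
theorem hess_sub_nonpos (A : IsAdmissibleCone V h U)
    (H : IsSmoothHomogeneous V h k) (Hq : IsSmoothHomogeneous V q k) (hε : 0 < ε)
    (hql : ∀ x ∈ posCone h U, q x = l x ^ k) (hl : ∀ x ∈ posCone h U, 0 < l x)
    (hx : x ∈ posCone h U) (h0 : 0 ≤ h x - ε * q x) {v : E}
    (hv : fderiv ℝ (fun y => h y - ε * q y) x v = 0) :
    fderiv ℝ (fderiv ℝ fun y => h y - ε * q y) x v v ≤ 0 ∧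
      (fderiv ℝ (fderiv ℝ fun y => h y - ε * q y) x v v = 0 → ∃ c : ℝ, c • x = v) := by
  have hxV := A.subset hx.1
  have hk := H.pos
  have hk1 := H.one_lt
  have hlx := hl x hx
  have hqe : q =ᶠ[𝓝 x] fun y => l y ^ k := by
    filter_upwards [(H.isOpen_posCone A.isOpen A.subset).mem_nhds hx] with y hy using hql y hy
  have hqd : fderiv ℝ q x v = k * l x ^ (k - 1) * l v := by
    rw [hqe.fderiv_eq, (IsSmoothHomogeneous.hasFDerivAt_rpow_clm l hlx k).fderiv]; simp
  have hqh : fderiv ℝ (fderiv ℝ q) x v v = k * (k - 1) * l x ^ (k - 2) * l v ^ 2 := by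
    rw [hqe.fderiv.fderiv_eq, IsSmoothHomogeneous.hess_rpow_clm l hlx]
  rw [(H.hasFDerivAt_sub Hq hxV).fderiv, sub_apply, smul_apply, hqd, smul_eq_mul] at hv
  rw [H.hess_sub Hq hxV]
  simp only [sub_apply, smul_apply, smul_eq_mul, hqh]
  obtain ⟨h1, h2⟩ := H.hess_decomp hxV hx.2.ne' v
  set w := v - (fderiv ℝ h x v / (k * h x)) • x with hw
  rw [hql x hx] at h0
  have hP1 : l x ^ (k - 1) = l x ^ (k - 2) * l x := by
    rw [← Real.rpow_add_one hlx.ne']; ring_nf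
  have hP2 : l x ^ k = l x ^ (k - 2) * l x * l x := by
    rw [← hP1, ← Real.rpow_add_one hlx.ne']; ring_nf
  have hpow : 0 < l x ^ (k - 2) := Real.rpow_pos_of_pos hlx _
  have hD : fderiv ℝ h x v = ε * (k * (l x ^ (k - 2) * l x) * l v) := by
    rw [← hP1]; linarith
  have hx2 := hx.2
  -- Substituting dh(v) = ε k l^(k-1) l(v) makes the radial term of D²h and the Hessian of ε l^k
  -- combine into a nonpositive multiple of h - ε l^k.
  have h3 : (k - 1) / k * fderiv ℝ h x v ^ 2 / h x -
      ε * (k * (k - 1) * l x ^ (k - 2) * l v ^ 2) =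
      -(k * (k - 1) * ε * l x ^ (k - 2) * l v ^ 2 / h x * (h x - ε * l x ^ k)) := by
    rw [hD, hP2]; field_simp; ring
  have h4 : 0 ≤ k * (k - 1) * ε * l x ^ (k - 2) * l v ^ 2 / h x * (h x - ε * l x ^ k) := by
    have : 0 ≤ k - 1 := by linarith
    positivity
  by_cases hw0 : w = 0
  · rw [hw0] at h2
    simp only [map_zero] at h2
    refine ⟨by linarith, fun _ => ⟨_, (sub_eq_zero.1 (hw ▸ hw0)).symm⟩⟩
  · have h5 := A.hess_neg H x hx w hw0 h1
    exact ⟨by linarith, fun h6 => by linarith⟩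

theorem concaveOn_rpow [FiniteDimensional ℝ E] (A : IsAdmissibleCone V h U)
    (H : IsSmoothHomogeneous V h k) : ConcaveOn ℝ (posCone h U) fun x => h x ^ (1 / k) := by
  refine ⟨A.convex H, fun x hx y hy a b ha hb hab => ?_⟩
  have h1 := (H.concaveOn_lineMap A.subset (A.hess_neg H)
    ((A.convex H).segment_subset hx hy)).2 (x := 0) (y := 1) (by simp) (by simp) ha hb hab
  have h2 : (AffineMap.lineMap x y b : E) = a • x + b • y := by
    rw [AffineMap.lineMap_apply_module, ← hab, add_sub_cancel_right]
  simpa [h2] using h1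

/-- On the cone, h > ε l^k is equivalent to h^(1/k) > ε^(1/k) l, a strict superlevel condition for a
concave minus a linear function. -/
theorem convex_sub [FiniteDimensional ℝ E] (A : IsAdmissibleCone V h U)
    (H : IsSmoothHomogeneous V h k) (hε : 0 < ε)
    (hql : ∀ x ∈ posCone h U, q x = l x ^ k) (hl : ∀ x ∈ posCone h U, 0 < l x) :
    Convex ℝ (posCone (fun y => h y - ε * q y) (posCone h U)) := by
  have hk : 0 < 1 / k := one_div_pos.2 H.pos
  have h1 := ((A.concaveOn_rpow H).sub
    ((((ε ^ (1 / k)) • l : E →L[ℝ] ℝ) : E →ₗ[ℝ] ℝ).convexOn (A.convex H))).convex_gt 0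
  convert h1 using 1
  ext x
  refine and_congr_right fun hx => ?_
  have h2 : ε * q x = (ε ^ (1 / k) * l x) ^ k := by
    rw [hql x hx, Real.mul_rpow (Real.rpow_nonneg hε.le _) (hl x hx).le, ← Real.rpow_mul hε.le,
      one_div_mul_cancel H.pos.ne', Real.rpow_one]
  have h3 : h x = (h x ^ (1 / k)) ^ k := by
    rw [← Real.rpow_mul hx.2.le, one_div_mul_cancel H.pos.ne', Real.rpow_one]
  simp only [sub_pos, Pi.sub_apply]
  rw [h2]
  nth_rewrite 1 [h3]
  exact Real.rpow_lt_rpow_iff (mul_nonneg (Real.rpow_nonneg hε.le _) (hl x hx).le)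
    (Real.rpow_nonneg hx.2.le _) H.pos

theorem regular_sub [FiniteDimensional ℝ E] (A : IsAdmissibleCone V h U)
    (H : IsSmoothHomogeneous V h k) (Hq : IsSmoothHomogeneous V q k) (hε : 0 < ε) (hε1 : ε < 1)
    (hp : p ∈ unitLevelSet h U) (hlp : l = (1 / k) • fderiv ℝ h p)
    (hql : ∀ x ∈ closure (posCone h U), x ≠ 0 → q x = l x ^ k) :
    IsAdmissibleCone V (fun y => h y - ε * q y) (posCone h U) ∧
      HasRegularBoundary (fun y => h y - ε * q y)
        (unitLevelSet (fun y => h y - ε * q y) (posCone h U)) := by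
  have hk := H.pos
  have hpP := unitLevelSet_subset hp
  have hPo := H.isOpen_posCone A.isOpen A.subset
  have hPc := H.isCone_posCone A.isCone A.subset
  have hPV : posCone h U ⊆ V := fun x hx => A.subset hx.1
  have hP0 : ∀ x ∈ posCone h U, x ≠ 0 := fun x hx h0 =>
    H.zero_notMem_posCone A.subset (h0 ▸ hx)
  have hcl : closure (posCone h U) \ {0} ⊆ V := fun x hx =>
    A.closure_subset ⟨closure_mono (fun y hy => hy.1) hx.1, hx.2⟩
  have hlpos : ∀ x ∈ closure (posCone h U), x ≠ 0 → 0 < l x := fun x hx hx0 => by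
    rw [hlp, smul_apply, smul_eq_mul]
    exact mul_pos (one_div_pos.2 hk) (A.fderiv_pos H hpP hx hx0)
  have hql' : ∀ x ∈ posCone h U, q x = l x ^ k := fun x hx =>
    hql x (subset_closure hx) (hP0 x hx)
  have hl' : ∀ x ∈ posCone h U, 0 < l x := fun x hx => hlpos x (subset_closure hx) (hP0 x hx)
  have hlp1 : l p = 1 := by
    rw [hlp, smul_apply, H.euler p (A.subset hp.1), hp.2, smul_eq_mul]; field_simp
  have Hε := H.sub_const_mul Hq ε
  have hqpos : ∀ x ∈ closure (posCone h U), x ∈ V → x ≠ 0 → 0 < q x := fun x hx _ hx0 => by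
    rw [hql x hx hx0]; exact Real.rpow_pos_of_pos (hlpos x hx hx0) k
  have hzero : ∀ x ∈ V, 0 < h x - ε * q x → x ≠ 0 := by
    rintro x hx h0 rfl
    have h1 := Hε.euler 0 hx
    rw [map_zero] at h1
    exact (mul_pos hk h0).ne h1
  -- Positivity of h - ε q forces h > 0, so completeness of the old hypersurface puts x in the old
  -- open cone; that cone serves as U for the new function.
  have hclosed : ∀ x ∈ closure (posCone h U), x ∈ V → 0 < h x - ε * q x → x ∈ posCone h U := by
    intro x hx hxV h0
    have := mul_pos hε (hqpos x hx hxV (hzero x hxV h0))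
    exact A.mem_posCone H x hx hxV (by linarith)
  constructor
  · refine Hε.isAdmissibleCone hPo hPc hPV hcl
      ((A.convex_sub H hε hql' hl').isConnected ⟨p, hpP, ?_⟩) hclosed ?_
    · simp only
      rw [hql' p hpP, hlp1, hp.2, Real.one_rpow]; linarith
    · intro x hx v hv0 hv
      obtain ⟨h1, h2⟩ := A.hess_sub_nonpos H Hq hε hql' hl' hx.1 hx.2.le hv
      refine h1.lt_of_ne fun h3 => ?_
      obtain ⟨c, rfl⟩ := h2 h3
      rw [map_smul, Hε.euler x (hPV hx.1), smul_eq_mul] at hv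
      have h4 := hx.2
      have hc : c = 0 := by
        rcases mul_eq_zero.1 hv with h | h
        · exact h
        · exact absurd h (mul_pos hk h4).ne'
      exact hv0 (by rw [hc, zero_smul])
  · refine Hε.hasRegularBoundary hPo hPc hPV hcl (fun x hx hxV h0 =>
      ⟨hclosed x (closure_mono (fun y hy => hy.1) hx) hxV h0, h0⟩) ?_
    intro x hx hxV hx0 h0
    have hxc : x ∈ closure (posCone h U) := closure_mono (fun y hy => hy.1) hx
    have hxP : x ∈ posCone h U := by
      have := mul_pos hε (hqpos x hxc hxV hx0)
      exact A.mem_posCone H x hxc hxV (by linarith)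
    refine ⟨fun hd => ?_, fun v hv => A.hess_sub_nonpos H Hq hε hql' hl' hxP h0.ge hv⟩
    have hlx := hl' x hxP
    have hqe : q =ᶠ[𝓝 x] fun y => l y ^ k := by
      filter_upwards [hPo.mem_nhds hxP] with y hy using hql' y hy
    have h1 := congrArg (fun L : E →L[ℝ] ℝ => L p) hd
    rw [(H.hasFDerivAt_sub Hq hxV).fderiv, hqe.fderiv_eq,
      (IsSmoothHomogeneous.hasFDerivAt_rpow_clm l hlx k).fderiv] at h1
    simp only [sub_apply, smul_apply, smul_eq_mul, hlp1, zero_apply] at h1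
    -- The differential is tested on p. Concavity gives dh_x(p) ≥ k h(x)^(1 - 1/k) = k ε^(1 - 1/k)
    -- l(x)^(k-1). Since ε < 1, this exceeds ε k l(x)^(k-1), the differential of ε l^k on p.
    have h2 := H.le_fderiv A.subset (A.hess_neg H) ((A.convex H).segment_subset hxP hpP)
    rw [hp.2, Real.one_rpow] at h2
    have h3 : h x = ε * l x ^ k := by rw [hql' x hxP] at h0; linarith
    have h4 : h x ^ (1 - 1 / k) = ε ^ (1 - 1 / k) * l x ^ (k - 1) := by
      rw [h3, Real.mul_rpow hε.le (Real.rpow_nonneg hlx.le _), ← Real.rpow_mul hlx.le,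
        mul_sub, mul_one, mul_one_div_cancel hk.ne']
    rw [h4] at h2
    have h5 : ε ^ (1 : ℝ) < ε ^ (1 - 1 / k) :=
      Real.rpow_lt_rpow_of_exponent_gt hε hε1 (by have := one_div_pos.2 hk; linarith)
    rw [Real.rpow_one] at h5
    have h6 : 0 < k * l x ^ (k - 1) := mul_pos hk (Real.rpow_pos_of_pos hlx _)
    nlinarith

end IsAdmissibleCone

namespace SmoothFunctions

variable {V : TopologicalSpace.Opens E}

theorem isTopologicalAddGroup : IsTopologicalAddGroup (SmoothFunctions V) :=
  (smoothSeminorms V).addGroupFilterBasis.isTopologicalAddGroup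

theorem continuousSMul : ContinuousSMul ℝ (SmoothFunctions V) :=
  (smoothSeminorms V).moduleFilterBasis.continuousSMul

theorem isSmoothHomogeneous {k : ℝ} (hk : 1 < k) {h : SmoothFunctions V}
    (hh : IsHomogeneousOn h.toFun V k) : IsSmoothHomogeneous (V : Set E) h.toFun k :=
  ⟨V.isOpen, h.property.1, hh, hk⟩

theorem dense_regularHyperbolicFunctions [FiniteDimensional ℝ E] {k : ℝ} (hk : 1 < k)
    (V : TopologicalSpace.Opens E) :
    Dense {h : ↥(hyperbolicFunctions V k) |
      (h : SmoothFunctions V) ∈ regularHyperbolicFunctions V k} := by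
  rintro ⟨h, hh⟩
  refine closure_subtype.2 ?_
  obtain ⟨hhom, U, A⟩ := hh
  have H := isSmoothHomogeneous hk hhom
  obtain ⟨p, hp⟩ := A.connected.nonempty
  obtain ⟨δ, hδ, hle⟩ := A.exists_le_fderiv H (unitLevelSet_subset hp)
  obtain ⟨q, Hq, hq0, hql⟩ := A.exists_extension H ((1 / k) • fderiv ℝ h.toFun p)
    (div_pos hδ H.pos) fun x hx => by
      rw [smul_apply, smul_eq_mul, div_mul_eq_mul_div, one_div_mul_eq_div]
      exact div_le_div_of_nonneg_right (hle x hx) H.pos.le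
  let Q : SmoothFunctions V := ⟨q, Hq.smooth, hq0⟩
  have hsub : ∀ ε : ℝ, (h - ε • Q).toFun = fun y => h.toFun y - ε * q y := fun ε => rfl
  have htend : Tendsto (fun ε : ℝ => h - ε • Q) (𝓝[>] 0) (𝓝 h) := by
    have := isTopologicalAddGroup (V := V)
    have := continuousSMul (V := V)
    have h1 : Continuous fun ε : ℝ => h - ε • Q := by fun_prop
    have h2 : Tendsto (fun ε : ℝ => h - ε • Q) (𝓝 0) (𝓝 (h - (0 : ℝ) • Q)) := h1.tendsto 0
    rw [zero_smul, sub_zero] at h2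
    exact h2.mono_left nhdsWithin_le_nhds
  refine mem_closure_of_tendsto htend ?_
  filter_upwards [Ioo_mem_nhdsGT (one_pos : (0 : ℝ) < 1)] with ε hε
  have hreg := A.regular_sub H Hq hε.1 hε.2 hp rfl hql
  have hF : h - ε • Q ∈ hyperbolicFunctions V k := by
    refine ⟨?_, posCone h.toFun U, ?_⟩
    · rw [hsub]; exact (H.sub_const_mul Hq ε).euler
    · rw [hsub]; exact hreg.1
  refine ⟨⟨h - ε • Q, hF⟩, ⟨hF, posCone h.toFun U, ?_⟩, rfl⟩
  rw [hsub]
  exact hreg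

end SmoothFunctions

end Density
/-! ### Bilinear forms which are negative definite on a hyperplane -/

section NegOnHyperplane

variable {E : Type*} [NormedAddCommGroup E] [NormedSpace ℝ E]

/-- The form `Q` is negative definite on the kernel of some linear functional. -/
def IsNegOnHyperplane (Q : E →L[ℝ] E →L[ℝ] ℝ) : Prop :=
  ∃ b : E →L[ℝ] ℝ, ∀ v, v ≠ 0 → b v = 0 → Q v v < 0

/-- The same hyperplane works for nearby forms, by compactness of its unit sphere. -/
theorem isOpen_isNegOnHyperplane [FiniteDimensional ℝ E] :
    IsOpen {Q : E →L[ℝ] E →L[ℝ] ℝ | IsNegOnHyperplane Q} := by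
  rw [isOpen_iff_mem_nhds]
  rintro Q ⟨b, hb⟩
  have hK : IsCompact (Metric.sphere (0 : E) 1 ∩ {v | b v = 0}) :=
    (isCompact_sphere 0 1).inter_right (isClosed_eq b.continuous continuous_const)
  have hcont : Continuous fun z : (E →L[ℝ] E →L[ℝ] ℝ) × E => z.1 z.2 z.2 := by fun_prop
  have := hK.eventually_forall_of_forall_eventually (x₀ := Q)
    (P := fun Q' v => Q' v v < 0) (fun v hv => hcont.continuousAt.eventually
      (gt_mem_nhds (hb v (Metric.ne_of_mem_sphere hv.1 one_ne_zero) hv.2)))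
  filter_upwards [this] with Q' hQ'
  refine ⟨b, fun v hv0 hv => ?_⟩
  have hn : 0 < ‖v‖ := norm_pos_iff.2 hv0
  have h1 := hQ' (‖v‖⁻¹ • v) ⟨by simp [norm_smul, hn.ne'], by simp [hv]⟩
  simp only [map_smul, smul_apply, smul_eq_mul] at h1
  have h2 := inv_pos.2 hn
  by_contra h3
  push Not at h3
  exact absurd h1 (not_lt.2 (mul_nonneg h2.le (mul_nonneg h2.le h3)))

theorem IsNegOnHyperplane.of_smul_eq {Q Q' : E →L[ℝ] E →L[ℝ] ℝ} (hQ : IsNegOnHyperplane Q)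
    {t s : ℝ} (hs : 0 < s) (h : t • t • Q' = s • Q) : IsNegOnHyperplane Q' := by
  obtain ⟨b, hb⟩ := hQ
  refine ⟨b, fun v hv0 hv => ?_⟩
  have h1 := congrArg (fun L : E →L[ℝ] E →L[ℝ] ℝ => L v v) h
  simp only [smul_apply, smul_eq_mul] at h1
  have h2 := mul_neg_of_pos_of_neg hs (hb v hv0 hv)
  nlinarith [mul_self_nonneg t]

/-- A form which is negative semidefinite on the orthogonal complement of the null vector `x`, with
kernel spanned by `x`, is negative definite on a hyperplane. -/
theorem isNegOnHyperplane_of_null {Q : E →L[ℝ] E →L[ℝ] ℝ} (hsymm : ∀ v w, Q v w = Q w v)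
    {x e : E} (hxx : Q x x = 0) (hxe : 0 < Q x e)
    (hQ : ∀ w, Q x w = 0 → Q w w ≤ 0 ∧ (Q w w = 0 → ∃ c : ℝ, c • x = w)) :
    IsNegOnHyperplane Q := by
  set a := Q x e with ha
  obtain ⟨f, hff, hxf⟩ : ∃ f, Q f f = 0 ∧ Q x f = a := by
    -- Adding a multiple of the null vector x makes e null without changing its pairing with x, so x
    -- and f span a hyperbolic plane.
    refine ⟨e + (-(Q e e) / (2 * a)) • x, ?_, ?_⟩
    · simp only [map_add, map_smul, add_apply, smul_apply, smul_eq_mul, hxx, hsymm e x, ← ha]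
      field_simp; ring
    · simp only [map_add, map_smul, smul_eq_mul, hxx, ← ha]; ring
  have hfx : Q f x = a := by rw [hsymm, hxf]
  -- The hyperplane is the Q-orthogonal complement of x + f. It contains the negative vector x - f;
  -- removing that component from v leaves w orthogonal to both x and f.
  refine ⟨Q x + Q f, fun v hv0 hv => ?_⟩
  rw [add_apply] at hv
  set s := Q x v with hs
  have hfv : Q f v = -s := by linarith
  set w := v + (s / a) • x - (s / a) • f with hw
  have hxw : Q x w = 0 := by
    simp only [hw, map_add, map_sub, map_smul, smul_eq_mul, hxx, hxf, ← hs]; field_simp; ring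
  have hww : Q w w = Q v v + 2 * s ^ 2 / a := by
    have h1 : Q v x = s := by rw [hsymm]
    have h2 : Q v f = -s := by rw [hsymm, hfv]
    simp only [hw, map_add, map_sub, map_smul, smul_eq_mul, add_apply, sub_apply, smul_apply,
      hxx, hff, hxf, hfx, h1, h2, hfv, ← hs]
    field_simp; ring
  obtain ⟨h1, h2⟩ := hQ w hxw
  have h3 : 0 ≤ 2 * s ^ 2 / a := by positivity
  refine lt_of_le_of_ne (by linarith) fun h4 => hv0 ?_
  have h5 : 2 * s ^ 2 / a = 0 := by linarith
  have hs0 : s = 0 := by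
    rw [div_eq_zero_iff] at h5
    rcases h5 with h5 | h5
    · simpa using h5
    · exact absurd h5 hxe.ne'
  have hwv : w = v := by simp [hw, hs0]
  obtain ⟨c, hc⟩ := h2 (by rw [hww, h4, h5, add_zero])
  rw [hwv] at hc
  rw [← hc, map_smul, hfx, hs0, smul_eq_mul, neg_zero] at hfv
  rw [← hc, (mul_eq_zero.1 hfv).resolve_right hxe.ne', zero_smul]

/-- The Hessian is nonnegative on x and on v, which are orthogonal for it, so it is nonnegative on
their span. The combination b(v) x - b(x) v lies in the negative hyperplane ker b, hence is zero;
and b(x) ≠ 0, since x itself is not negative. -/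
theorem IsSmoothHomogeneous.exists_smul_eq {V : Set E} {h : E → ℝ} {k : ℝ} {x v : E}
    (H : IsSmoothHomogeneous V h k) (hx : x ∈ V) (hx0 : x ≠ 0) (h0 : 0 ≤ h x)
    (hneg : IsNegOnHyperplane (fderiv ℝ (fderiv ℝ h) x)) (hv : fderiv ℝ h x v = 0)
    (hvv : 0 ≤ fderiv ℝ (fderiv ℝ h) x v v) : ∃ c : ℝ, c • x = v := by
  obtain ⟨b, hb⟩ := hneg
  have hxx : 0 ≤ fderiv ℝ (fderiv ℝ h) x x x := by
    rw [H.hess_self hx]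
    exact mul_nonneg (mul_nonneg (by linarith [H.one_lt]) H.pos.le) h0
  have hxv : fderiv ℝ (fderiv ℝ h) x x v = 0 := by rw [H.hess_self_left hx, hv, mul_zero]
  have hvx : fderiv ℝ (fderiv ℝ h) x v x = 0 := by rw [H.hess_comm hx, hxv]
  have hbx : b x ≠ 0 := fun h1 => absurd (hb x hx0 h1) (not_lt.2 hxx)
  have hw : b v • x - b x • v = 0 := by
    by_contra hw
    have h1 := hb _ hw (by simp only [map_sub, map_smul, smul_eq_mul]; ring)
    simp only [map_sub, map_smul, smul_eq_mul, sub_apply, smul_apply, hxv, hvx] at h1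
    nlinarith [mul_nonneg (mul_self_nonneg (b v)) hxx, mul_nonneg (mul_self_nonneg (b x)) hvv]
  refine ⟨(b x)⁻¹ * b v, ?_⟩
  rw [mul_smul, sub_eq_zero.1 hw, inv_smul_smul₀ hbx]

theorem IsSmoothHomogeneous.hess_nonpos {V : Set E} {h : E → ℝ} {k : ℝ} {x v : E}
    (H : IsSmoothHomogeneous V h k) (hx : x ∈ V) (hx0 : x ≠ 0) (h0 : 0 ≤ h x)
    (hneg : IsNegOnHyperplane (fderiv ℝ (fderiv ℝ h) x)) (hv : fderiv ℝ h x v = 0) :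
    fderiv ℝ (fderiv ℝ h) x v v ≤ 0 := by
  by_contra hlt
  push Not at hlt
  obtain ⟨c, rfl⟩ := H.exists_smul_eq hx hx0 h0 hneg hv hlt.le
  rw [map_smul, smul_eq_mul] at hv
  rw [map_smul, map_smul, smul_apply, H.hess_self_left hx, smul_eq_mul, smul_eq_mul,
    mul_left_comm c (k - 1), hv] at hlt
  simp at hlt

theorem IsSmoothHomogeneous.hess_neg_of_pos {V : Set E} {h : E → ℝ} {k : ℝ} {x v : E}
    (H : IsSmoothHomogeneous V h k) (hx : x ∈ V) (hx0 : x ≠ 0) (h0 : 0 < h x)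
    (hneg : IsNegOnHyperplane (fderiv ℝ (fderiv ℝ h) x)) (hv0 : v ≠ 0)
    (hv : fderiv ℝ h x v = 0) : fderiv ℝ (fderiv ℝ h) x v v < 0 := by
  by_contra hlt
  push Not at hlt
  obtain ⟨c, rfl⟩ := H.exists_smul_eq hx hx0 h0.le hneg hv hlt
  rw [map_smul, H.euler x hx, smul_eq_mul] at hv
  rcases mul_eq_zero.1 hv with h1 | h1
  · exact hv0 (by rw [h1, zero_smul])
  · exact (mul_pos H.pos h0).ne' h1

end NegOnHyperplane

/-! ### The boundary of the cone of a regular hypersurface -/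

section Boundary

variable {E : Type*} [NormedAddCommGroup E] [NormedSpace ℝ E]

/-- Every vector in the kernel of `dh` is the velocity of a smooth curve in the level set. -/
theorem exists_curve_of_fderiv_ne_zero [CompleteSpace E] {V N : Set E} {h : E → ℝ} {x v : E}
    (hV : IsOpen V) (hh : ContDiffOn ℝ ∞ h V) (hx : x ∈ V) (hd : fderiv ℝ h x ≠ 0)
    (hv : fderiv ℝ h x v = 0) (hN : N ∈ 𝓝 x) :
    ∃ γ, IsCurveIn (N ∩ {y | h y = h x}) x γ ∧ deriv γ 0 = v := by
  obtain ⟨u, hu⟩ : ∃ u, fderiv ℝ h x u ≠ 0 := by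
    by_contra! hcon
    exact hd (ContinuousLinearMap.ext hcon)
  obtain ⟨e, he⟩ : ∃ e, fderiv ℝ h x e = 1 :=
    ⟨(fderiv ℝ h x u)⁻¹ • u, by simp [hu]⟩
  -- Φ has derivative the identity at x and satisfies dh_x(Φ(y) - x) = h(y) - h(x). Its local
  -- inverse therefore carries the line x + t v into the level set of h.
  set Φ : E → E := fun y => y + (h y - h x - fderiv ℝ h x (y - x)) • e with hΦ
  have hΦs : ∀ y ∈ V, ContDiffAt ℝ ∞ Φ y := fun y hy =>
    contDiffAt_id.add ((((hh.contDiffAt (hV.mem_nhds hy)).sub contDiffAt_const).sub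
      ((fderiv ℝ h x).contDiff.comp (contDiff_id.sub contDiff_const)).contDiffAt).smul
        contDiffAt_const)
  have hΦx : Φ x = x := by simp [hΦ]
  have hΦd : HasFDerivAt Φ ((ContinuousLinearEquiv.refl ℝ E : E ≃L[ℝ] E) : E →L[ℝ] E) x := by
    have h1 : HasFDerivAt h (fderiv ℝ h x) x :=
      ((hh.contDiffAt (hV.mem_nhds hx)).differentiableAt (by simp)).hasFDerivAt
    have h2 : HasFDerivAt (fun y => fderiv ℝ h x (y - x)) (fderiv ℝ h x) x :=
      (fderiv ℝ h x).hasFDerivAt.comp x ((hasFDerivAt_id x).sub_const x)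
    refine ((hasFDerivAt_id x).add (((h1.sub_const (h x)).sub h2).smul_const e)).congr_fderiv ?_
    ext w; simp
  set F := (hΦs x hx).toOpenPartialHomeomorph Φ hΦd (by simp) with hF
  have hFΦ : ∀ y, F y = Φ y := fun y => rfl
  have hxs : x ∈ F.source := (hΦs x hx).mem_toOpenPartialHomeomorph_source hΦd (by simp)
  have hxt : x ∈ F.target := by
    have := F.map_source hxs
    rwa [hFΦ, hΦx] at this
  have hFx : F.symm x = x := by
    have := F.left_inv hxs
    rwa [hFΦ, hΦx] at this
  -- Invertibility of DΦ near x, not only at x, makes the curve smooth on a whole interval.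
  have hgood : ∀ᶠ y in 𝓝 x, y ∈ V ∧ y ∈ N ∧
      fderiv ℝ Φ y ∈ range ((↑) : (E ≃L[ℝ] E) → E →L[ℝ] E) := by
    have hc : ContinuousAt (fderiv ℝ Φ) x :=
      ((hΦs x hx).fderiv_right (m := ∞) (by simp)).continuousAt
    have h1 := hc.preimage_mem_nhds (t := range ((↑) : (E ≃L[ℝ] E) → E →L[ℝ] E)) (by
      rw [hΦd.fderiv]; exact ContinuousLinearEquiv.nhds _)
    filter_upwards [hV.mem_nhds hx, hN, h1] with y h1 h2 h3 using ⟨h1, h2, h3⟩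
  have hsc : ContinuousAt F.symm x := F.continuousAt_symm hxt
  have hline : Continuous fun t : ℝ => x + t • v := by fun_prop
  have hev : ∀ᶠ t in 𝓝 (0 : ℝ), x + t • v ∈ F.target ∧ (F.symm (x + t • v) ∈ V ∧
      F.symm (x + t • v) ∈ N ∧ fderiv ℝ Φ (F.symm (x + t • v)) ∈
        range ((↑) : (E ≃L[ℝ] E) → E →L[ℝ] E)) := by
    have h1 : Tendsto (fun t : ℝ => x + t • v) (𝓝 0) (𝓝 x) := by
      simpa using hline.tendsto 0
    have h2 : Tendsto F.symm (𝓝 x) (𝓝 x) := by simpa [ContinuousAt, hFx] using hsc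
    exact (h1.eventually (F.open_target.mem_nhds hxt)).and
      ((h2.comp h1).eventually hgood)
  obtain ⟨δ, hδ, hb⟩ := Metric.eventually_nhds_iff_ball.1 hev
  rw [Real.ball_eq_Ioo, zero_sub, zero_add] at hb
  refine ⟨fun t => F.symm (x + t • v), ⟨by simp [hFx], δ, hδ, ?_, ?_⟩, ?_⟩
  · intro t ht
    obtain ⟨h1, h2, -, L, hL⟩ := hb t ht
    have h3 : HasFDerivAt F (L : E →L[ℝ] E) (F.symm (x + t • v)) := by
      rw [hL]; exact ((hΦs _ h2).differentiableAt (by simp)).hasFDerivAt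
    have hl : ContDiffAt ℝ ∞ (fun t : ℝ => x + t • v) t := by fun_prop
    exact ((F.contDiffAt_symm h1 h3 (hΦs _ h2)).comp t hl).contDiffWithinAt
  · intro t ht
    obtain ⟨h1, h2, h3, -⟩ := hb t ht
    refine ⟨h3, ?_⟩
    have h4 : Φ (F.symm (x + t • v)) = x + t • v := F.right_inv h1
    have h5 := congrArg (fun y => fderiv ℝ h x (y - x)) h4
    simp only [hΦ, add_sub_right_comm _ _ x, map_add, map_smul, he, hv, sub_self,
      map_zero, smul_eq_mul, mul_one, mul_zero] at h5
    rw [mem_ofPred_eq]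
    linarith
  · have h1 : HasDerivAt (fun t : ℝ => x + t • v) v 0 := by
      simpa using ((hasDerivAt_id (0 : ℝ)).smul_const v).const_add x
    have h2 : HasFDerivAt F.symm
        ((ContinuousLinearEquiv.refl ℝ E).symm : E →L[ℝ] E) (x + (0 : ℝ) • v) := by
      rw [zero_smul, add_zero]
      refine F.hasFDerivAt_symm hxt ?_
      rw [hFx]; exact hΦd
    have h3 := HasFDerivAt.comp_hasDerivAt (f := fun t : ℝ => x + t • v) 0 h2 h1
    simpa using! h3.deriv

theorem IsSmoothHomogeneous.lt_of_fderiv_pos {V : Set E} {h : E → ℝ} {k : ℝ}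
    (H : IsSmoothHomogeneous V h k) {x p : E} {s : ℝ} (hs : 0 < s)
    (hp : ∀ t ∈ Icc 0 s, x + t • p ∈ V ∧ 0 < fderiv ℝ h (x + t • p) p) :
    h x < h (x + s • p) := by
  have hder : ∀ t ∈ Icc 0 s, HasDerivAt (fun t : ℝ => h (x + t • p))
      (fderiv ℝ h (x + t • p) p) t := by
    intro t ht
    have h1 : HasDerivAt (fun t : ℝ => x + t • p) p t := by
      simpa using ((hasDerivAt_id t).smul_const p).const_add x
    exact HasFDerivAt.comp_hasDerivAt (f := fun t : ℝ => x + t • p) t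
      (H.differentiableAt (hp t ht).1).hasFDerivAt h1
  have hmono := strictMonoOn_of_deriv_pos (convex_Icc 0 s)
    (fun t ht => (hder t ht).continuousAt.continuousWithinAt) (fun t ht => by
      rw [(hder t (interior_subset ht)).deriv]; exact (hp t (interior_subset ht)).2)
  have := hmono (left_mem_Icc.2 hs.le) (right_mem_Icc.2 hs.le) hs
  simpa using this

namespace IsAdmissibleCone

variable [FiniteDimensional ℝ E] {V U : Set E} {h : E → ℝ} {k : ℝ} {p x : E}

theorem add_smul_mem (A : IsAdmissibleCone V h U) (H : IsSmoothHomogeneous V h k)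
    (hp : p ∈ posCone h U) (hx : x ∈ closure (posCone h U)) {t : ℝ} (ht : 0 < t) :
    x + t • p ∈ posCone h U := by
  have hPo := H.isOpen_posCone A.isOpen A.subset
  have hPc := H.isCone_posCone A.isCone A.subset
  have := (A.convex H).add_smul_mem_of_isCone hPo hPc (hPc t ht p hp) hx zero_le_one
  rwa [one_smul, add_comm] at this

/-- Since h(x) = 0 and h(x + t v) > 0 for v in the cone, dh_x is nonnegative on the cone. A zero at
the interior point p would make it nonnegative in every direction, hence zero. -/
theorem fderiv_pos_of_ne_zero (A : IsAdmissibleCone V h U) (H : IsSmoothHomogeneous V h k)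
    (hp : p ∈ posCone h U) (hx : x ∈ closure (posCone h U)) (hxV : x ∈ V) (h0 : h x = 0)
    (hd : fderiv ℝ h x ≠ 0) : 0 < fderiv ℝ h x p := by
  have hnn : ∀ v ∈ posCone h U, 0 ≤ fderiv ℝ h x v := by
    intro v hv
    have h1 : HasDerivAt (fun t : ℝ => x + t • v) v 0 := by
      simpa using ((hasDerivAt_id (0 : ℝ)).smul_const v).const_add x
    have h2 : HasFDerivAt h (fderiv ℝ h x) (x + (0 : ℝ) • v) := by
      simpa using (H.differentiableAt hxV).hasFDerivAt
    have h3 : HasDerivAt (fun t : ℝ => h (x + t • v)) (fderiv ℝ h x v) 0 :=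
      HasFDerivAt.comp_hasDerivAt (f := fun t : ℝ => x + t • v) 0 h2 h1
    refine ge_of_tendsto h3.tendsto_slope_zero_right ?_
    filter_upwards [self_mem_nhdsWithin] with t ht
    have ht : 0 < t := ht
    have h4 := (A.add_smul_mem H hv hx ht).2
    simp only [zero_add, zero_smul, add_zero, h0, sub_zero, smul_eq_mul]
    positivity
  refine (hnn p hp).lt_of_ne fun hp0 => hd ?_
  ext u
  rw [zero_apply]
  have hmem : ∀ u : E, 0 ≤ fderiv ℝ h x u := by
    intro u
    have hl : Continuous fun t : ℝ => p + t • u := by fun_prop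
    have h1 : ∀ᶠ t in 𝓝[>] (0 : ℝ), p + t • u ∈ posCone h U := by
      refine (hl.tendsto 0).mono_left nhdsWithin_le_nhds |>.eventually ?_
      simpa using (H.isOpen_posCone A.isOpen A.subset).mem_nhds hp
    obtain ⟨t, ht1, ht0⟩ := (h1.and self_mem_nhdsWithin).exists
    have ht0 : 0 < t := ht0
    have h2 := hnn _ ht1
    rw [map_add, ← hp0, zero_add, map_smul, smul_eq_mul] at h2
    exact nonneg_of_mul_nonneg_right h2 ht0
  have h1 := hmem (-u)
  rw [map_neg] at h1
  linarith [hmem u]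

/-- Near a boundary point where the differential does not vanish, the closed cone is the set where
`h` is nonnegative. -/
theorem eventually_mem_closure (A : IsAdmissibleCone V h U) (H : IsSmoothHomogeneous V h k)
    (hp : p ∈ posCone h U) (hx : x ∈ closure (posCone h U)) (hxV : x ∈ V)
    (hd : 0 < fderiv ℝ h x p) : ∀ᶠ z in 𝓝 x, 0 ≤ h z → z ∈ closure (posCone h U) := by
  have hPo := H.isOpen_posCone A.isOpen A.subset
  have hev : ∀ᶠ y in 𝓝 x, y ∈ V ∧ 0 < fderiv ℝ h y p := by
    have hc : ContinuousAt (fun y => fderiv ℝ h y p) x :=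
      (H.contDiffAt_fderiv hxV).continuousAt.clm_apply continuousAt_const
    filter_upwards [H.isOpen.mem_nhds hxV, hc.eventually (lt_mem_nhds hd)] with y h1 h2
      using ⟨h1, h2⟩
  obtain ⟨r, hr, hb⟩ := Metric.eventually_nhds_iff_ball.1 hev
  obtain ⟨τ, hτ, hτr⟩ : ∃ τ > 0, τ * ‖p‖ < r / 2 := by
    refine ⟨r / 2 / (‖p‖ + 1), by positivity, ?_⟩
    rw [div_mul_eq_mul_div, div_lt_iff₀ (by positivity)]
    nlinarith [norm_nonneg p]
  have hshift : ∀ᶠ z in 𝓝 x, z + τ • p ∈ posCone h U :=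
    (show Continuous fun z => z + τ • p by fun_prop).continuousAt.eventually
      (hPo.mem_nhds (A.add_smul_mem H hp hx hτ))
  filter_upwards [Metric.ball_mem_nhds x (half_pos hr), hshift] with z hz hzτ h0
  have hball : ∀ t ∈ Icc 0 τ, z + t • p ∈ V ∧ 0 < fderiv ℝ h (z + t • p) p := by
    intro t ht
    refine hb _ ?_
    rw [Metric.mem_ball] at hz ⊢
    have h1 : dist (z + t • p) z ≤ τ * ‖p‖ := by
      rw [dist_eq_norm, add_sub_cancel_left, norm_smul, Real.norm_of_nonneg ht.1]
      exact mul_le_mul_of_nonneg_right ht.2 (norm_nonneg p)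
    linarith [dist_triangle (z + t • p) z x]
  have hpos : ∀ t ∈ Ioc 0 τ, 0 < h (z + t • p) := fun t ht =>
    h0.trans_lt (H.lt_of_fderiv_pos ht.1 fun s hs => hball s ⟨hs.1, hs.2.trans ht.2⟩)
  have hl : Continuous fun t : ℝ => z + t • p := by fun_prop
  -- Since h increases in the direction p, it is positive on this half-open segment, whose far end
  -- lies in the cone. The cone is open and relatively closed where h > 0, so it contains the whole
  -- segment, and z is a limit of its points.
  have hsub : (fun t : ℝ => z + t • p) '' Ioc 0 τ ⊆ posCone h U := by
    refine (isPreconnected_Ioc.image _ hl.continuousOn).subset_of_closure_inter_subset hPo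
      ⟨z + τ • p, mem_image_of_mem _ (right_mem_Ioc.2 hτ), hzτ⟩ ?_
    rintro _ ⟨hcl, t, ht, rfl⟩
    exact A.mem_posCone H _ hcl (hball t ⟨ht.1.le, ht.2⟩).1 (hpos t ht)
  have ht0 : Tendsto (fun t : ℝ => z + t • p) (𝓝[>] 0) (𝓝 z) := by
    have := (hl.tendsto 0).mono_left (nhdsWithin_le_nhds (s := Ioi (0 : ℝ)))
    simpa using this
  refine mem_closure_of_tendsto ht0 ?_
  filter_upwards [Ioc_mem_nhdsGT hτ] with t ht using hsub (mem_image_of_mem _ ht)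

/-- The Hessian at the points of the closed cone of a hypersurface with regular boundary
behaviour. -/
theorem isNegOnHyperplane_of_hasRegularBoundary (A : IsAdmissibleCone V h U)
    (H : IsSmoothHomogeneous V h k) (hreg : HasRegularBoundary h (unitLevelSet h U))
    (hp : p ∈ posCone h U) (hx : x ∈ closure (posCone h U)) (hx0 : x ≠ 0) :
    IsNegOnHyperplane (fderiv ℝ (fderiv ℝ h) x) ∧ 0 < fderiv ℝ h x p := by
  have hPo := H.isOpen_posCone A.isOpen A.subset
  by_cases hxP : x ∈ posCone h U
  · exact ⟨⟨fderiv ℝ h x, A.hess_neg H x hxP⟩, A.fderiv_pos H hxP (subset_closure hp)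
      fun h0 => H.zero_notMem_posCone A.subset (h0 ▸ hp)⟩
  have hxF : x ∈ frontier (posCone h U) \ {0} := ⟨by rw [hPo.frontier_eq]; exact ⟨hx, hxP⟩, hx0⟩
  have hzero := fun {y} => H.eq_zero_of_mem_frontier (p := y) A.isOpen A.subset A.closure_subset
    (A.mem_posCone H)
  obtain ⟨-, hxV, h0⟩ := hzero hxF
  rw [HasRegularBoundary, H.coneOver_unitLevelSet A.isCone A.subset] at hreg
  obtain ⟨hd, hpsd, hrank⟩ := hreg x hxF
  have hdp := A.fderiv_pos_of_ne_zero H hp hx hxV h0 hd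
  refine ⟨?_, hdp⟩
  set S := frontier (posCone h U) \ {0} with hS
  set T := tangentSpaceAt S x with hT
  have hker : ∀ v ∈ T, fderiv ℝ h x v = 0 := fun v hv =>
    H.tangentSpaceAt_le_ker (c := 0) (fun y hy => (hzero hy).2.2) hxV hv
  -- Near x the level set {h = 0} consists of boundary points of the cone, so the tangent space is
  -- all of ker dh_x.
  have hmemT : ∀ v, fderiv ℝ h x v = 0 → v ∈ T := by
    intro v hv
    have hN : {z | 0 ≤ h z → z ∈ closure (posCone h U)} ∩ {0}ᶜ ∈ 𝓝 x :=
      inter_mem (A.eventually_mem_closure H hp hx hxV hdp) (isOpen_compl_singleton.mem_nhds hx0)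
    have := FiniteDimensional.complete ℝ E
    obtain ⟨γ, ⟨hγ0, δ, hδ, hγ, hmaps⟩, hγv⟩ :=
      exists_curve_of_fderiv_ne_zero H.isOpen H.smooth hxV hd hv hN
    refine Submodule.subset_span ⟨γ, ⟨hγ0, δ, hδ, hγ, fun t ht => ?_⟩, hγv⟩
    obtain ⟨⟨h1, h2⟩, h3⟩ := hmaps ht
    have h3 : h (γ t) = 0 := h3.trans h0
    refine ⟨?_, h2⟩
    rw [hPo.frontier_eq]
    exact ⟨h1 h3.ge, fun h4 => h4.2.ne' h3⟩
  have hxT : x ∈ T := hmemT x (by rw [H.euler x hxV, h0, mul_zero])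
  have hQT : ∀ v ∈ T, fderiv ℝ (fderiv ℝ h) x v v ≤ 0 := fun v hv => by
    have : 0 ≤ -(fderiv ℝ (fderiv ℝ h) x v v) := hpsd v hv
    linarith
  have hk1 : k - 1 ≠ 0 := by linarith [H.one_lt]
  refine isNegOnHyperplane_of_null (x := x) (e := p) (H.hess_comm hxV)
    (by rw [H.hess_self hxV, h0, mul_zero])
    (by rw [H.hess_self_left hxV]; exact mul_pos (by linarith [H.one_lt]) hdp) ?_
  intro w hw
  rw [H.hess_self_left hxV, mul_eq_zero] at hw
  have hwT := hmemT w (hw.resolve_left hk1)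
  refine ⟨hQT w hwT, fun hww => ?_⟩
  -- A null vector of a semidefinite form is in its radical. The coefficient of w is chosen so that
  -- the form would take the positive value 1.
  have hrad : ∀ u ∈ T, fderiv ℝ (fderiv ℝ h) x w u = 0 := by
    intro u hu
    by_contra hne
    set b := fderiv ℝ (fderiv ℝ h) x w u with hb
    set a := fderiv ℝ (fderiv ℝ h) x u u with ha
    have h1 := hQT (u + ((1 - a) / (2 * b)) • w) (T.add_mem hu (T.smul_mem _ hwT))
    simp only [map_add, map_smul, add_apply, smul_apply, smul_eq_mul, H.hess_comm hxV u w, hww,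
      ← hb, ← ha, mul_zero, add_zero] at h1
    have h2 : a + (1 - a) / (2 * b) * b + (1 - a) / (2 * b) * b = 1 := by field_simp; ring
    linarith
  have hkx : (⟨x, hxT⟩ : T) ∈ LinearMap.ker ((-hessianForm h x).restrict T) := by
    rw [LinearMap.mem_ker]
    ext u
    simp [hessianForm, H.hess_self_left hxV, hker u u.2]
  have hkw : (⟨w, hwT⟩ : T) ∈ LinearMap.ker ((-hessianForm h x).restrict T) := by
    rw [LinearMap.mem_ker]
    ext u
    simp [hessianForm, hrad u u.2]
  obtain ⟨c, hc⟩ := exists_smul_eq_of_finrank_eq_one hrank (x := ⟨⟨x, hxT⟩, hkx⟩)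
    (fun h => hx0 (by simpa using congrArg (fun a => (a.1.1 : E)) h)) ⟨⟨w, hwT⟩, hkw⟩
  exact ⟨c, congrArg (fun a => (a.1.1 : E)) hc⟩

end IsAdmissibleCone

end Boundary
/-! ### Openness -/

section Openness

variable {E : Type*}

/-- The image of K under the jet J h is compact in O, so some δ-thickening of it stays in O. The
seminorm of order m on K bounds the change of the jet by δ. -/
theorem SmoothFunctions.eventually_forall_mem [NormedAddCommGroup E] [NormedSpace ℝ E]
    {F : Type*} [NormedAddCommGroup F] {V : TopologicalSpace.Opens E}
    (J : SmoothFunctions V → E → F) (m : ℕ)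
    (hJ : ∀ f g : SmoothFunctions V, ∀ x ∈ V,
      ‖J f x - J g x‖ ≤ ‖iteratedFDeriv ℝ m (f - g).toFun x‖)
    (h : SmoothFunctions V) {K : Set E} {O : Set F} (hK : IsCompact K) (hKV : K ⊆ V)
    (hO : IsOpen O) (hc : ∀ x ∈ V, ContinuousAt (J h) x) (hKO : ∀ x ∈ K, J h x ∈ O) :
    ∀ᶠ g in 𝓝 h, ∀ x ∈ K, J g x ∈ O := by
  have hcK : ContinuousOn (J h) K := fun x hx => (hc x (hKV hx)).continuousWithinAt
  obtain ⟨δ, hδ, hsub⟩ := (hK.image_of_continuousOn hcK).exists_thickening_subset_open hO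
    (image_subset_iff.2 hKO)
  let i : {K : TopologicalSpace.Compacts E // (K : Set E) ⊆ V} × ℕ := (⟨⟨K, hK⟩, hKV⟩, m)
  have hws : WithSeminorms (smoothSeminorms V) := ⟨rfl⟩
  have hcont : Continuous (smoothSeminorms V i) := hws.continuous_seminorm i
  have hsubc : Continuous fun g : SmoothFunctions V => g - h := by
    have := (smoothSeminorms V).addGroupFilterBasis.isTopologicalAddGroup
    exact continuous_id.sub continuous_const
  have hev : ∀ᶠ g in 𝓝 h, smoothSeminorms V i (g - h) < δ := by
    refine (hcont.comp hsubc).continuousAt.eventually (gt_mem_nhds ?_)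
    simpa using hδ
  filter_upwards [hev] with g hg x hx
  refine hsub (Metric.mem_thickening_iff.2 ⟨J h x, mem_image_of_mem _ hx, ?_⟩)
  rw [dist_eq_norm]
  refine (hJ g h x (hKV hx)).trans_lt (lt_of_le_of_lt ?_ hg)
  exact le_ciSup ((g - h).bddAbove m ⟨⟨K, hK⟩, hKV⟩) (⟨x, hx⟩ : K)

section Cone

variable [NormedAddCommGroup E] [NormedSpace ℝ E] [FiniteDimensional ℝ E]
  {V O C : Set E} {h : E → ℝ} {k : ℝ} {p : E}

/-- The cone over the part of `O` in the unit sphere. -/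
def sphericalCone (O : Set E) : Set E := {x | x ≠ 0 ∧ ‖x‖⁻¹ • x ∈ O}

/-- A criterion for regular boundary behaviour in terms of finitely many open conditions on
compact sets. -/
theorem IsSmoothHomogeneous.regular_sphericalCone (H : IsSmoothHomogeneous V h k) (hV : IsCone V)
    (hO : IsOpen O) (hC : IsClosed C) (hOC : O ⊆ C) (hCV : C ∩ Metric.sphere 0 1 ⊆ V)
    (l : E →L[ℝ] ℝ) (hl : ∀ x ∈ C ∩ Metric.sphere 0 1, 0 < l x)
    (hpO : p ∈ O) (hp1 : ‖p‖ = 1) (hp : 0 < h p)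
    (hneg : ∀ x ∈ C ∩ Metric.sphere 0 1, x ∉ O → h x < 0)
    (hder : ∀ x ∈ C ∩ Metric.sphere 0 1, 0 < fderiv ℝ h x p)
    (hhess : ∀ x ∈ C ∩ Metric.sphere 0 1, IsNegOnHyperplane (fderiv ℝ (fderiv ℝ h) x)) :
    IsAdmissibleCone V h (sphericalCone O) ∧
      HasRegularBoundary h (unitLevelSet h (sphericalCone O)) := by
  have hnorm : ContinuousOn (fun x : E => ‖x‖⁻¹ • x) {0}ᶜ :=
    (continuous_norm.continuousOn.inv₀ fun x hx => norm_ne_zero_iff.2 hx).smul continuousOn_id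
  have hWo : IsOpen (sphericalCone O) := hnorm.isOpen_inter_preimage isOpen_compl_singleton hO
  have hWc : IsCone (sphericalCone O) := by
    intro t ht x hx
    refine ⟨smul_ne_zero ht.ne' hx.1, ?_⟩
    rw [norm_smul, Real.norm_of_nonneg ht.le, mul_inv, mul_comm, mul_smul, inv_smul_smul₀ ht.ne']
    exact hx.2
  have hclC : ∀ x ∈ closure (sphericalCone O), x ≠ 0 →
      ‖x‖⁻¹ • x ∈ C ∩ Metric.sphere 0 1 := by
    intro x hx hx0
    refine ⟨?_, by simp [norm_smul, hx0]⟩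
    have hc : ContinuousWithinAt (fun x : E => ‖x‖⁻¹ • x) (sphericalCone O) x :=
      (hnorm.continuousAt (isOpen_compl_singleton.mem_nhds hx0)).continuousWithinAt
    exact hC.closure_subset_iff.2 hOC (hc.mem_closure hx fun y hy => hy.2)
  have hscale : ∀ x : E, x ≠ 0 → ‖x‖ • ‖x‖⁻¹ • x = x := fun x hx0 =>
    smul_inv_smul₀ (norm_ne_zero_iff.2 hx0) x
  -- That V is a cone is essential here: only the unit vectors are known to lie in V.
  have hmemV : ∀ x ∈ closure (sphericalCone O), x ≠ 0 → x ∈ V := fun x hx hx0 => by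
    rw [← hscale x hx0]
    exact hV _ (norm_pos_iff.2 hx0) _ (hCV (hclC x hx hx0))
  have hWV : sphericalCone O ⊆ V := fun x hx => hmemV x (subset_closure hx) hx.1
  have hcl : closure (sphericalCone O) \ {0} ⊆ V := fun x hx => hmemV x hx.1 hx.2
  have hl' : ∀ x ∈ closure (sphericalCone O), x ≠ 0 → 0 < l x := fun x hx hx0 => by
    rw [← hscale x hx0, map_smul, smul_eq_mul]
    exact mul_pos (norm_pos_iff.2 hx0) (hl _ (hclC x hx hx0))
  have hder' : ∀ x ∈ closure (sphericalCone O), x ≠ 0 → 0 < fderiv ℝ h x p := by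
    intro x hx hx0
    have hn := norm_pos_iff.2 hx0
    have h1 := H.fderiv_smul H.isOpen hV Subset.rfl (hCV (hclC x hx hx0)) hn
    rw [hscale x hx0] at h1
    have h2 := congrArg (fun L : E →L[ℝ] ℝ => L p) h1
    simp only [smul_apply, smul_eq_mul] at h2
    have h3 := mul_pos (Real.rpow_pos_of_pos hn k) (hder _ (hclC x hx hx0))
    rw [← h2] at h3
    exact pos_of_mul_pos_right h3 hn.le
  have hhess' : ∀ x ∈ closure (sphericalCone O), x ≠ 0 →
      IsNegOnHyperplane (fderiv ℝ (fderiv ℝ h) x) := by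
    intro x hx hx0
    have hn := norm_pos_iff.2 hx0
    have h1 := H.hess_smul H.isOpen hV Subset.rfl (hCV (hclC x hx hx0)) hn
    rw [hscale x hx0] at h1
    exact (hhess _ (hclC x hx hx0)).of_smul_eq (Real.rpow_pos_of_pos hn k) h1
  have hneg' : ∀ x ∈ closure (sphericalCone O), x ≠ 0 → x ∉ sphericalCone O → h x < 0 := by
    intro x hx hx0 hxW
    have hn := norm_pos_iff.2 hx0
    rw [← hscale x hx0, H.homog_of_mem_cone hV Subset.rfl (hCV (hclC x hx hx0)) hn]
    exact mul_neg_of_pos_of_neg (Real.rpow_pos_of_pos hn k)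
      (hneg _ (hclC x hx hx0) fun hxO => hxW ⟨hx0, hxO⟩)
  have hclosed : ∀ x ∈ closure (sphericalCone O), x ∈ V → 0 < h x → x ∈ sphericalCone O := by
    intro x hx hxV h0
    have hx0 : x ≠ 0 := by
      rintro rfl
      have h1 := H.euler 0 hxV
      rw [map_zero] at h1
      exact (mul_pos H.pos h0).ne h1
    by_contra hxW
    exact lt_asymm h0 (hneg' x hx hx0 hxW)
  have hp0 : p ≠ 0 := fun h0 => by simp [h0] at hp1
  have hpP : p ∈ posCone h (sphericalCone O) := ⟨⟨hp0, by simpa [hp1] using hpO⟩, hp⟩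
  have hlp := hl' p (subset_closure hpP.1) hp0
  -- The half-line from x in the direction p never leaves the cone. At a first exit point h would be
  -- negative, whereas h increases along the way because dh(p) > 0. The functional l, positive on
  -- the cone, keeps the half-line away from 0.
  have hmove : ∀ x ∈ posCone h (sphericalCone O), ∀ t : ℝ, 0 ≤ t →
      x + t • p ∈ posCone h (sphericalCone O) := by
    intro x hx
    have hline : Continuous fun t : ℝ => x + t • p := by fun_prop
    have hne : ∀ t : ℝ, 0 ≤ t → x + t • p ≠ 0 := by
      intro t ht h0
      have h1 := congrArg l h0
      rw [map_add, map_smul, smul_eq_mul, map_zero] at h1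
      have h2 := hl' x (subset_closure hx.1) hx.1.1
      have h3 := mul_nonneg ht hlp.le
      linarith
    have hup : ∀ s : ℝ, 0 ≤ s → (∀ t ∈ Icc 0 s, x + t • p ∈ closure (sphericalCone O)) →
        0 < h (x + s • p) := by
      intro s hs hs'
      rcases hs.eq_or_lt with rfl | hs0
      · simpa using hx.2
      · exact hx.2.trans (H.lt_of_fderiv_pos hs0 fun t ht =>
          ⟨hmemV _ (hs' t ht) (hne t ht.1), hder' _ (hs' t ht) (hne t ht.1)⟩)
    have hin : ∀ t : ℝ, 0 ≤ t → x + t • p ∈ sphericalCone O := by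
      by_contra! hcon
      set T : Set ℝ := Ici 0 ∩ (fun t : ℝ => x + t • p) ⁻¹' (sphericalCone O)ᶜ with hT
      have hTc : IsClosed T := isClosed_Ici.inter (hWo.isClosed_compl.preimage hline)
      have hTn : T.Nonempty := let ⟨t, ht0, ht⟩ := hcon; ⟨t, ht0, ht⟩
      have hTb : BddBelow T := ⟨0, fun t ht => ht.1⟩
      obtain ⟨hs0, hsW⟩ := hTc.csInf_mem hTn hTb
      set s := sInf T
      have hs0 : 0 ≤ s := hs0
      have hlt : ∀ t, 0 ≤ t → t < s → x + t • p ∈ sphericalCone O := by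
        intro t ht0 hts
        by_contra hcon
        have htT : t ∈ T := ⟨ht0, hcon⟩
        exact (csInf_le hTb htT).not_gt hts
      have hspos : 0 < s := hs0.lt_of_ne fun h0 => hsW (by rw [← h0]; simpa using hx.1)
      have hscl : x + s • p ∈ closure (sphericalCone O) := by
        refine mem_closure_of_tendsto
          ((hline.tendsto s).mono_left (nhdsWithin_le_nhds (s := Iio s))) ?_
        filter_upwards [Ioo_mem_nhdsLT hspos] with t ht using hlt t ht.1.le ht.2
      have h1 := hup s hs0 fun t ht => by
        rcases ht.2.eq_or_lt with rfl | hts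
        · exact hscl
        · exact subset_closure (hlt t ht.1 hts)
      exact lt_asymm h1 (hneg' _ hscl (hne s hs0) hsW)
    exact fun t ht => ⟨hin t ht, hup t ht fun s hs => subset_closure (hin s hs.1)⟩
  have hPc := H.isCone_posCone hWc hWV
  -- For b > 0, a p + b y = b (y + (a/b) p). Star-shapedness about p supplies the connectedness.
  have hstar : StarConvex ℝ p (posCone h (sphericalCone O)) := by
    intro y hy a b ha hb hab
    rcases hb.eq_or_lt with rfl | hb0
    · rw [add_zero] at hab
      simpa [hab] using hpP
    · have h1 := hPc b hb0 _ (hmove y hy (a / b) (by positivity))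
      rwa [smul_add, smul_smul, mul_div_cancel₀ _ hb0.ne', add_comm] at h1
  constructor
  · exact H.isAdmissibleCone hWo hWc hWV hcl (hstar.isPathConnected hpP).isConnected hclosed
      fun x hx v hv0 hv => H.hess_neg_of_pos (hWV hx.1) hx.1.1 hx.2
        (hhess' x (subset_closure hx.1) hx.1.1) hv0 hv
  · refine H.hasRegularBoundary hWo hWc hWV hcl (fun x hx hxV h0 =>
      ⟨hclosed x (closure_mono (fun y hy => hy.1) hx) hxV h0, h0⟩) ?_
    intro x hx hxV hx0 h0
    have hx' : x ∈ closure (sphericalCone O) := closure_mono (fun y hy => hy.1) hx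
    refine ⟨fun hd => ?_, fun v hv => ?_⟩
    · have := hder' x hx' hx0
      rw [hd] at this
      exact lt_irrefl _ this
    · exact ⟨H.hess_nonpos hxV hx0 h0.ge (hhess' x hx' hx0) hv, fun hvv =>
        H.exists_smul_eq hxV hx0 h0.ge (hhess' x hx' hx0) hv hvv.ge⟩

/-- Each condition holds near every point of the compact spherical slice of the closed cone. The
last one makes h negative outside the closed cone. -/
theorem IsAdmissibleCone.exists_cthickening {U : Set E} (A : IsAdmissibleCone V h U)
    (H : IsSmoothHomogeneous V h k) (hreg : HasRegularBoundary h (unitLevelSet h U))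
    (hp : p ∈ posCone h U) :
    ∃ δ > 0, ∀ x ∈ Metric.cthickening δ (closure (posCone h U) ∩ Metric.sphere 0 1),
      x ∈ V ∧ IsNegOnHyperplane (fderiv ℝ (fderiv ℝ h) x) ∧ 0 < fderiv ℝ h x p ∧
        0 < fderiv ℝ h p x ∧ (0 ≤ h x → x ∈ closure (posCone h U)) := by
  set G := {x | x ∈ V ∧ IsNegOnHyperplane (fderiv ℝ (fderiv ℝ h) x) ∧ 0 < fderiv ℝ h x p ∧
    0 < fderiv ℝ h p x ∧ (0 ≤ h x → x ∈ closure (posCone h U))} with hG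
  have hK : IsCompact (closure (posCone h U) ∩ Metric.sphere 0 1) :=
    (isCompact_sphere 0 1).inter_left isClosed_closure
  obtain ⟨δ, hδ, hsub⟩ := hK.exists_cthickening_subset_open (isOpen_interior (s := G)) (by
    rintro x ⟨hx, hx1⟩
    have hx0 : x ≠ 0 := Metric.ne_of_mem_sphere hx1 one_ne_zero
    have hxV : x ∈ V := A.closure_subset ⟨closure_mono (fun y hy => hy.1) hx, hx0⟩
    obtain ⟨h1, h2⟩ := A.isNegOnHyperplane_of_hasRegularBoundary H hreg hp hx hx0
    have hc : ContinuousAt (fun y => fderiv ℝ h y p) x :=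
      (H.contDiffAt_fderiv hxV).continuousAt.clm_apply continuousAt_const
    rw [mem_interior_iff_mem_nhds]
    filter_upwards [H.isOpen.mem_nhds hxV,
      (H.continuousAt_hess hxV).preimage_mem_nhds (isOpen_isNegOnHyperplane.mem_nhds h1),
      hc.eventually (lt_mem_nhds h2),
      (fderiv ℝ h p).continuous.continuousAt.eventually (lt_mem_nhds (A.fderiv_pos H hp hx hx0)),
      A.eventually_mem_closure H hp hx hxV h2] with y h1 h2 h3 h4 h5 using ⟨h1, h2, h3, h4, h5⟩)
  exact ⟨δ, hδ, fun x hx => (interior_subset (hsub hx) : x ∈ G)⟩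

end Cone

namespace SmoothFunctions

variable [NormedAddCommGroup E] [InnerProductSpace ℝ E]

theorem norm_fderiv_sub_le {V : TopologicalSpace.Opens E} (f g : SmoothFunctions V) {x : E}
    (hx : x ∈ V) :
    ‖fderiv ℝ f.toFun x - fderiv ℝ g.toFun x‖ ≤ ‖iteratedFDeriv ℝ 1 (f - g).toFun x‖ := by
  have h1 : fderiv ℝ (f - g).toFun x = fderiv ℝ f.toFun x - fderiv ℝ g.toFun x :=
    fderiv_sub ((f.contDiffAt hx).differentiableAt (by simp))
      ((g.contDiffAt hx).differentiableAt (by simp))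
  rw [← zero_add 1, ← norm_iteratedFDeriv_fderiv, norm_iteratedFDeriv_zero, h1]

theorem norm_hess_sub_le {V : TopologicalSpace.Opens E} (f g : SmoothFunctions V) {x : E}
    (hx : x ∈ V) :
    ‖fderiv ℝ (fderiv ℝ f.toFun) x - fderiv ℝ (fderiv ℝ g.toFun) x‖ ≤
      ‖iteratedFDeriv ℝ 2 (f - g).toFun x‖ := by
  have h1 : fderiv ℝ (f - g).toFun =ᶠ[𝓝 x] fderiv ℝ f.toFun - fderiv ℝ g.toFun := by
    filter_upwards [V.isOpen.mem_nhds hx] with y hy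
    exact fderiv_sub ((f.contDiffAt hy).differentiableAt (by simp))
      ((g.contDiffAt hy).differentiableAt (by simp))
  have hd : ∀ f : SmoothFunctions V, DifferentiableAt ℝ (fderiv ℝ f.toFun) x := fun f =>
    ((f.contDiffAt hx).fderiv_right (m := ∞) (by simp)).differentiableAt (by simp)
  rw [← one_add_one_eq_two, ← norm_iteratedFDeriv_fderiv, ← zero_add 1,
    ← norm_iteratedFDeriv_fderiv, norm_iteratedFDeriv_zero, h1.fderiv_eq, fderiv_sub (hd f) (hd g)]

theorem eventually_regular [FiniteDimensional ℝ E] {k : ℝ} (hk : 1 < k) {V : TopologicalSpace.Opens E}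
    (hV : IsCone (V : Set E)) {h : SmoothFunctions V} (hh : IsHomogeneousOn h.toFun V k)
    {U : Set E} (A : IsAdmissibleCone V h.toFun U)
    (hreg : HasRegularBoundary h.toFun (unitLevelSet h.toFun U)) :
    ∀ᶠ g in 𝓝 h, g ∈ hyperbolicFunctions V k → g ∈ regularHyperbolicFunctions V k := by
  have H := isSmoothHomogeneous hk hh
  have hPc := H.isCone_posCone A.isCone A.subset
  obtain ⟨p, hp, hp1⟩ : ∃ p ∈ posCone h.toFun U, ‖p‖ = 1 := by
    obtain ⟨p, hp⟩ := A.connected.nonempty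
    have hp := unitLevelSet_subset hp
    have hp0 : p ≠ 0 := fun h0 => H.zero_notMem_posCone A.subset (h0 ▸ hp)
    exact ⟨‖p‖⁻¹ • p, hPc _ (inv_pos.2 (norm_pos_iff.2 hp0)) p hp, by simp [norm_smul, hp0]⟩
  obtain ⟨δ, hδ, hG⟩ := A.exists_cthickening H hreg hp
  set K₀ := closure (posCone h.toFun U) ∩ Metric.sphere 0 1 with hK₀
  set K := Metric.cthickening δ K₀ ∩ Metric.sphere 0 1 with hK
  have hKc : IsCompact K := (isCompact_sphere 0 1).inter_left Metric.isClosed_cthickening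
  have hKV : K ⊆ V := fun x hx => (hG x hx.1).1
  have hOo : IsOpen (Metric.thickening δ K₀) := Metric.isOpen_thickening
  have hpK₀ : p ∈ K₀ := ⟨subset_closure hp, by simpa using hp1⟩
  have hpO : p ∈ Metric.thickening δ K₀ := Metric.self_subset_thickening hδ _ hpK₀
  have hJ0 : ∀ f g : SmoothFunctions V, ∀ x ∈ V,
      ‖f.toFun x - g.toFun x‖ ≤ ‖iteratedFDeriv ℝ 0 (f - g).toFun x‖ := fun f g x _ => by
    rw [norm_iteratedFDeriv_zero]; exact le_rfl
  -- On the compact rim K without the open thickening, h is negative: where h ≥ 0 the point would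
  -- belong to K₀, which lies inside the thickening.
  have e0 := eventually_forall_mem (fun f => f.toFun) 0 hJ0 h
    (hKc.inter_right hOo.isClosed_compl) (inter_subset_left.trans hKV) isOpen_Iio
    (fun x hx => H.continuousAt hx) (O := Iio 0) (by
      rintro x ⟨hx, hxO⟩
      by_contra h0
      exact hxO (Metric.self_subset_thickening hδ _
        ⟨(hG x hx.1).2.2.2.2 (not_lt.1 h0), hx.2⟩))
  have e1 := eventually_forall_mem (fun f => f.toFun) 0 hJ0 h isCompact_singleton
    (singleton_subset_iff.2 (A.subset hp.1)) isOpen_Ioi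
    (fun x hx => H.continuousAt hx) (O := Ioi 0) (by rintro x rfl; exact hp.2)
  have e2 := eventually_forall_mem (fun f => fderiv ℝ f.toFun) 1
    (fun f g x hx => norm_fderiv_sub_le f g hx) h hKc hKV
    (O := {L : E →L[ℝ] ℝ | 0 < L p})
    (isOpen_lt continuous_const (ContinuousLinearMap.apply ℝ ℝ p).continuous)
    (fun x hx => (H.contDiffAt_fderiv hx).continuousAt) (fun x hx => (hG x hx.1).2.2.1)
  have e3 := eventually_forall_mem (fun f => fderiv ℝ (fderiv ℝ f.toFun)) 2
    (fun f g x hx => norm_hess_sub_le f g hx) h hKc hKV isOpen_isNegOnHyperplane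
    (fun x hx => H.continuousAt_hess hx) (fun x hx => (hG x hx.1).2.1)
  filter_upwards [e0, e1, e2, e3] with g g0 g1 g2 g3 hg
  exact ⟨hg, _, (isSmoothHomogeneous hk hg.1).regular_sphericalCone hV hOo
    Metric.isClosed_cthickening (Metric.thickening_subset_cthickening δ K₀) hKV
    (fderiv ℝ h.toFun p) (fun x hx => (hG x hx.1).2.2.2.1) hpO hp1 (g1 p rfl)
    (fun x hx hxO => g0 x ⟨hx, hxO⟩) g2 g3⟩

theorem isOpen_regularHyperbolicFunctions [FiniteDimensional ℝ E] {k : ℝ} (hk : 1 < k)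
    {V : TopologicalSpace.Opens E} (hV : IsCone (V : Set E)) :
    IsOpen {h : ↥(hyperbolicFunctions V k) |
      (h : SmoothFunctions V) ∈ regularHyperbolicFunctions V k} := by
  rw [isOpen_iff_mem_nhds]
  rintro ⟨h, hF⟩ ⟨-, U, A, hreg⟩
  have hev := eventually_regular hk hV hF.1 A hreg
  have hcont : Continuous fun g : ↥(hyperbolicFunctions V k) => (g : SmoothFunctions V) :=
    continuous_subtype_val
  filter_upwards [(hcont.tendsto ⟨h, hF⟩).eventually hev] with g hg using hg g.2

end SmoothFunctions

end Openness

theorem theorem1p15 (n : ℕ) (k : ℝ) (hk : 1 < k)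
    (V : TopologicalSpace.Opens (EuclideanSpace ℝ (Fin (n + 1)))) :
    Dense {h : ↥(hyperbolicFunctions V k) |
        (h : SmoothFunctions V) ∈ regularHyperbolicFunctions V k} ∧
      (IsCone (V : Set (EuclideanSpace ℝ (Fin (n + 1)))) →
        IsOpen {h : ↥(hyperbolicFunctions V k) |
          (h : SmoothFunctions V) ∈ regularHyperbolicFunctions V k}) :=
  ⟨SmoothFunctions.dense_regularHyperbolicFunctions hk V,
    SmoothFunctions.isOpen_regularHyperbolicFunctions hk⟩
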